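/- Work with the root system $A_2$ in the coordinates $x=a_1\alpha_1^\vee+a_2\alpha_2^\vee$ with respect to the simple coroots, so that the coroot lattice is $Q^\vee=\mathbb{Z}^2$ and the fundamental coweights are $\omega_1^\vee=(\tfrac23,\tfrac13)$, $\omega_2^\vee=(\tfrac13,\tfrac23)$. The Weyl group $W$ is generated by the reflections $r_1(a_1,a_2)=(-a_1+a_2,a_2)$ and $r_2(a_1,a_2)=(a_1,a_1-a_2)$, and $F$ is the closed triangle with vertices $0,\omega_1^\vee,\omega_2^\vee$. Let $X=(X_1,X_2):\mathbb{R}^2\to\mathbb{R}^2$, $$X_1(a_1,a_2)=\cos 2\pi a_1+\cos 2\pi a_2+\cos 2\pi(a_1-a_2),\qquad X_2(a_1,a_2)=\sin 2\pi a_1-\sin 2\pi a_2-\sin 2\pi(a_1-a_2),$$ $$K(y_1,y_2)=-(y_1^2+y_2^2+9)^2+8(y_1^3-3y_1y_2^2)+108,\qquad \Omega=\{y\in\mathbb{R}^2: K(y)\ge 0\}.$$ Let $S_\rho(a)=e^{2\pi i(a_1+a_2)}-e^{2\pi i(-a_1+2a_2)}-e^{2\pi i(2a_1-a_2)}+e^{2\pi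 i(a_1-2a_2)}+e^{2\pi i(-2a_1+a_2)}-e^{-2\pi i(a_1+a_2)}$. For an integer $M\ge 1$ let $I_M$ be the set of triples $j=[s_0,s_1,s_2]$ of non-negative integers with $s_0+s_1+s_2=M$, and put $$x^{(j)}=\tfrac{s_1}{M}\omega_1^\vee+\tfrac{s_2}{M}\omega_2^\vee=\Big(\tfrac{2s_1+s_2}{3M},\tfrac{s_1+2s_2}{3M}\Big),\qquad y^{(j)}=X(x^{(j)}).$$ Let $\varepsilon_j=1,3,6$ according as exactly one, two or three of $s_0,s_1,s_2$ are nonzero. Then $\Omega=X(F)$; $K(X(a))=|S_\rho(a)|^2$ for all $a\in\mathbb{R}^2$; and for each $j\in I_M$ the number $\varepsilon_j$ is the number of points in the $W$-orbit of $x^{(j)}$ in the torus $\mathbb{R}^2/Q^\vee$. Moreover, for every complex polynomial $p\in\mathbb{C}[y_1,y_2]$ of total degree at most $2M-1$ (the $m$-degree of $A_2$, both dual marks being $1$), the function $pK^{-1/2}$ is integrable on $\Omega$ and $$\int_\Omega p(y_1,y_2)\,K(y_1,y_2)^{-1/2}\,dy_1\,dy_2=\frac{\pi^2}{9M^2}\sum_{j\in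 I_M}\varepsilon_j\,p\big(y^{(j)}\big).$$ -/

import Mathlib

/-!
The root system `A₂`. Points of the plane are given by their coordinates `(a₁, a₂)` in the basis
of simple coroots, `x = a₁ α₁^∨ + a₂ α₂^∨`; weights are given by their coordinates in the dual
basis of fundamental weights, so that `⟨λ, x⟩ = λ₁ a₁ + λ₂ a₂` and `Q^∨ = ℤ²`.
-/

noncomputable section

namespace A2

/-- The fundamental coweight `ω₁^∨ = (2/3) α₁^∨ + (1/3) α₂^∨`. -/
def coweight₁ : ℝ × ℝ := (2 / 3, 1 / 3)

/-- The fundamental coweight `ω₂^∨ = (1/3) α₁^∨ + (2/3) α₂^∨`. -/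
def coweight₂ : ℝ × ℝ := (1 / 3, 2 / 3)

/-- The reflection `x ↦ x - ⟨x, α₁⟩ α₁^∨`. -/
def r₁ : (ℝ × ℝ) ≃ₗ[ℝ] (ℝ × ℝ) :=
  LinearEquiv.ofInvolutive
    { toFun := fun a => (-a.1 + a.2, a.2)
      map_add' := fun a b => by ext <;> simp; ring
      map_smul' := fun c a => by ext <;> simp; ring }
    (fun a => by ext <;> simp)

/-- The reflection `x ↦ x - ⟨x, α₂⟩ α₂^∨`. -/
def r₂ : (ℝ × ℝ) ≃ₗ[ℝ] (ℝ × ℝ) :=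
  LinearEquiv.ofInvolutive
    { toFun := fun a => (a.1, a.1 - a.2)
      map_add' := fun a b => by ext <;> simp; ring
      map_smul' := fun c a => by ext <;> simp; ring }
    (fun a => by ext <;> simp)

/-- The Weyl group, generated by the two simple reflections. -/
def weyl : Subgroup ((ℝ × ℝ) ≃ₗ[ℝ] (ℝ × ℝ)) := Subgroup.closure {r₁, r₂}

/-- The projection of the plane onto the torus `ℝ² / Q^∨`. -/
def toTorus (a : ℝ × ℝ) : UnitAddCircle × UnitAddCircle :=
  ((a.1 : UnitAddCircle), (a.2 : UnitAddCircle))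

/-- The number of points in the Weyl group orbit of the class of `a` in the torus `ℝ² / Q^∨`. -/
def orbitSize (a : ℝ × ℝ) : ℕ := Set.ncard {t | ∃ w ∈ weyl, t = toTorus (w a)}

/-- The fundamental domain of the affine Weyl group, a closed triangle with vertices
`0`, `ω₁^∨`, `ω₂^∨`. -/
def F : Set (ℝ × ℝ) :=
  {x | ∃ u₀ u₁ u₂ : ℝ, 0 ≤ u₀ ∧ 0 ≤ u₁ ∧ 0 ≤ u₂ ∧ u₀ + u₁ + u₂ = 1 ∧
    x = u₁ • coweight₁ + u₂ • coweight₂}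

/-- The antisymmetric orbit function `S_λ`. -/
def S (l : ℤ × ℤ) (a : ℝ × ℝ) : ℂ :=
  let e : ℤ → ℤ → ℂ := fun m n =>
    Complex.exp (2 * Real.pi * Complex.I * ((m : ℂ) * a.1 + (n : ℂ) * a.2))
  e l.1 l.2 - e (-l.1) (l.1 + l.2) - e (l.1 + l.2) (-l.2)
    + e l.2 (-(l.1 + l.2)) + e (-(l.1 + l.2)) l.1 - e (-l.2) (-l.1)

/-- The map `X = (X₁, X₂)`. -/
def X (a : ℝ × ℝ) : ℝ × ℝ :=
  (Real.cos (2 * Real.pi * a.1) + Real.cos (2 * Real.pi * a.2)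
      + Real.cos (2 * Real.pi * (a.1 - a.2)),
    Real.sin (2 * Real.pi * a.1) - Real.sin (2 * Real.pi * a.2)
      - Real.sin (2 * Real.pi * (a.1 - a.2)))

/-- The weight polynomial `K`. -/
def K (y : ℝ × ℝ) : ℝ :=
  -(y.1 ^ 2 + y.2 ^ 2 + 9) ^ 2 + 8 * (y.1 ^ 3 - 3 * y.1 * y.2 ^ 2) + 108

/-- The integration domain. -/
def Omega : Set (ℝ × ℝ) := {y | 0 ≤ K y}

/-- The index set of all `[s₀, s₁, s₂]` of natural numbers with `s₀ + s₁ + s₂ = M`. -/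
def I (M : ℕ) : Finset (Fin 3 → ℕ) := Finset.Nat.antidiagonalTuple 3 M

/-- The grid point `(s₁ / M) ω₁^∨ + (s₂ / M) ω₂^∨` labelled by `[s₀, s₁, s₂]`. -/
def gridPoint (M : ℕ) (j : Fin 3 → ℕ) : ℝ × ℝ :=
  ((2 * (j 1 : ℝ) + j 2) / (3 * M), ((j 1 : ℝ) + 2 * j 2) / (3 * M))

/-- The cubature node labelled by `[s₀, s₁, s₂]`. -/
def node (M : ℕ) (j : Fin 3 → ℕ) : ℝ × ℝ := X (gridPoint M j)

/-- The tabulated weights: `1`, `3`, `6` when exactly one, two, three of the entries are nonzero. -/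
def eps (j : Fin 3 → ℕ) : ℕ :=
  if (j 1 = 0 ∧ j 2 = 0) ∨ (j 0 = 0 ∧ j 2 = 0) ∨ (j 0 = 0 ∧ j 1 = 0) then 1
  else if j 0 = 0 ∨ j 1 = 0 ∨ j 2 = 0 then 3
  else 6

/-- The dual marks of `A₂`. -/
def dualMarks : Fin 2 → ℕ := ![1, 1]

/-- Complex polynomials in two variables of `m`-degree at most `N`. -/
def Pi (N : ℕ) : Set (MvPolynomial (Fin 2) ℂ) :=
  {p | p.weightedTotalDegree dualMarks ≤ N}

/-- The value of a complex polynomial at a real point. -/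
def value (p : MvPolynomial (Fin 2) ℂ) (y : ℝ × ℝ) : ℂ :=
  MvPolynomial.eval ![(y.1 : ℂ), (y.2 : ℂ)] p

end A2

end

open MeasureTheory

namespace A2

/-! Put `u = ex a₁`, `v = ex (-a₂)`, `w = ex (a₂ - a₁)`. Then `uvw = 1`, and since these are unit
numbers, `X a`, read as a complex number `z`, is `u + v + w`, while its conjugate is `uv + vw + wu`.
So `X a` encodes the monic cubic with roots `u, v, w`. The Weyl group permutes the roots, which
makes `X` a complete invariant modulo the affine Weyl group (`X_eq_iff`). `K` is minus the
discriminant and `S_ρ` is the Vandermonde product, a purely imaginary number, whence `K ∘ X =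
|S_ρ|²`. Conversely, the root set of the cubic with coefficients `z`, `conj z`, `1` is stable under
`t ↦ 1 / conj t`, and a root off the unit circle forces `K < 0` (`norm_eq_one_of_K_nonneg`). Hence
`Ω = X(F)`.

For the cubature, the Jacobian of `X` is a constant multiple of `|S_ρ|`, so it cancels `K ^ (-1/2)`,
and the integral becomes that of `p ∘ X` over a triangle (`abs_det_smul_ae_eq`). By invariance this
is one sixth of the integral over a period cell (`integral_cell_eq_six_mul`).

For `deg p ≤ 2M - 1`, `p ∘ X` is a trigonometric polynomial with frequencies in a hexagon
(`value_X_mem`). Summing a character over `P^∨/M` modulo `Q^∨` gives zero unless its weight lies in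
`M` times the root lattice, and the only such weight in the hexagon is `0` (`sum_box_expFun`). So
the lattice average equals the integral. Grouping lattice points by their image under `X` produces
the nodes, with orbit sizes as weights (`sum_box_eq_sum_I`). -/

/-! ### Characters of the circle. -/

/-- The character `x ↦ exp (2π i x)` of the real line. -/
noncomputable def ex (x : ℝ) : ℂ := Complex.exp (2 * Real.pi * x * Complex.I)

lemma ex_add (x y : ℝ) : ex (x + y) = ex x * ex y := by
  rw [ex, ex, ex, ← Complex.exp_add]; congr 1; push_cast; ring

lemma ex_zero : ex 0 = 1 := by simp [ex]

lemma conj_ex (x : ℝ) : (starRingEnd ℂ) (ex x) = ex (-x) := by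
  rw [ex, ex, ← Complex.exp_conj]; congr 1
  simp only [map_mul, Complex.conj_ofReal, Complex.conj_I, map_ofNat, Complex.ofReal_neg]
  ring

lemma ex_eq_cos_sin (x : ℝ) :
    ex x = Real.cos (2 * Real.pi * x) + Real.sin (2 * Real.pi * x) * Complex.I := by
  rw [ex, Complex.exp_mul_I]; push_cast; rfl

lemma ex_eq_ex_iff (x y : ℝ) : ex x = ex y ↔ ∃ n : ℤ, x = y + n := by
  rw [ex, ex, Complex.exp_eq_exp_iff_exists_int]
  have hpi : (2 * Real.pi * Complex.I : ℂ) ≠ 0 := Complex.two_pi_I_ne_zero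
  refine exists_congr fun n => ⟨fun h => ?_, fun h => ?_⟩
  · have : (2 * Real.pi * Complex.I : ℂ) * x = (2 * Real.pi * Complex.I) * ((y + n : ℝ) : ℂ) := by
      push_cast; linear_combination h
    exact_mod_cast mul_left_cancel₀ hpi this
  · rw [h]; push_cast; ring

lemma ex_eq_one_iff (x : ℝ) : ex x = 1 ↔ ∃ n : ℤ, x = n := by
  rw [← ex_zero, ex_eq_ex_iff]; simp

lemma ex_natCast_mul (n : ℕ) (x : ℝ) : ex (n * x) = ex x ^ n := by
  rw [ex, ex, ← Complex.exp_nat_mul]; congr 1; push_cast; ring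

lemma exists_eq_ex {z : ℂ} (hz : ‖z‖ = 1) : ∃ x : ℝ, z = ex x := by
  refine ⟨z.arg / (2 * Real.pi), ?_⟩
  have h := Complex.norm_mul_exp_arg_mul_I z
  rw [hz] at h
  rw [ex]
  nth_rewrite 1 [← h]
  have : (Real.pi : ℂ) ≠ 0 := by exact_mod_cast Real.pi_ne_zero
  simp only [Complex.ofReal_one, one_mul]
  congr 1; push_cast; field_simp

lemma ex_prod_eq_one (a : ℝ × ℝ) : ex a.1 * ex (-a.2) * ex (a.2 - a.1) = 1 := by
  rw [← ex_add, ← ex_add, ← ex_zero]; congr 1; ring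

/-! ### `X` as elementary symmetric functions, `K` as a discriminant. -/

/-- The point of the complex plane with the given real coordinates. -/
def toComplex (y : ℝ × ℝ) : ℂ := ⟨y.1, y.2⟩

lemma toComplex_injective : Function.Injective toComplex := fun y y' h => by
  have := Complex.ext_iff.1 h
  exact Prod.ext this.1 this.2

lemma toComplex_X (a : ℝ × ℝ) : toComplex (X a) = ex a.1 + ex (-a.2) + ex (a.2 - a.1) := by
  have h : 2 * Real.pi * (a.2 - a.1) = -(2 * Real.pi * (a.1 - a.2)) := by ring
  have h' : 2 * Real.pi * (-a.2) = -(2 * Real.pi * a.2) := by ring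
  rw [ex_eq_cos_sin, ex_eq_cos_sin, ex_eq_cos_sin, h, h']
  apply Complex.ext
  · simp [toComplex, X, -Complex.ofReal_cos, -Complex.ofReal_sin]
  · simp [toComplex, X, -Complex.ofReal_cos, -Complex.ofReal_sin]; ring

lemma conj_toComplex_X (a : ℝ × ℝ) :
    (starRingEnd ℂ) (toComplex (X a)) = ex a.1 * ex (-a.2) + ex (-a.2) * ex (a.2 - a.1)
      + ex (a.2 - a.1) * ex a.1 := by
  rw [toComplex_X, map_add, map_add, conj_ex, conj_ex, conj_ex, ← ex_add, ← ex_add, ← ex_add]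
  ring_nf

/-- Both triples are the roots of the same monic cubic: `u'` is one of its roots, and `v'` is then a
root of the quadratic cofactor. -/
lemma perm_of_esymm_eq {R : Type*} [CommRing R] [IsDomain R] {u v w u' v' w' : R}
    (h₁ : u' + v' + w' = u + v + w)
    (h₂ : u' * v' + v' * w' + w' * u' = u * v + v * w + w * u) (h₃ : u' * v' * w' = u * v * w) :
    (u' = u ∧ v' = v) ∨ (u' = u ∧ v' = w) ∨ (u' = v ∧ v' = u) ∨ (u' = v ∧ v' = w) ∨
      (u' = w ∧ v' = u) ∨ (u' = w ∧ v' = v) := by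
  have hu : (u' - u) * ((u' - v) * (u' - w)) = 0 := by
    linear_combination u' ^ 2 * h₁ - u' * h₂ + h₃
  simp only [mul_eq_zero, sub_eq_zero] at hu
  rcases hu with rfl | rfl | rfl
  · have hv : (v' - v) * (v' - w) = 0 := by
      linear_combination (v' + u') * h₁ - h₂
    simp only [mul_eq_zero, sub_eq_zero] at hv
    tauto
  · have hv : (v' - u) * (v' - w) = 0 := by
      linear_combination (v' + u') * h₁ - h₂
    simp only [mul_eq_zero, sub_eq_zero] at hv
    tauto
  · have hv : (v' - u) * (v' - v) = 0 := by
      linear_combination (v' + u') * h₁ - h₂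
    simp only [mul_eq_zero, sub_eq_zero] at hv
    tauto

lemma ofReal_K (y : ℝ × ℝ) :
    (K y : ℂ) = -(toComplex y * (starRingEnd ℂ) (toComplex y) + 9) ^ 2
      + 4 * (toComplex y ^ 3 + (starRingEnd ℂ) (toComplex y) ^ 3) + 108 := by
  have h1 : toComplex y = y.1 + y.2 * Complex.I := by
    apply Complex.ext <;> simp [toComplex]
  have h2 : (starRingEnd ℂ) (toComplex y) = y.1 - y.2 * Complex.I := by
    apply Complex.ext <;> simp [toComplex]
  have h3 : toComplex y * (starRingEnd ℂ) (toComplex y) = y.1 ^ 2 + y.2 ^ 2 := by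
    rw [h2, h1]; linear_combination (-(y.2 : ℂ) ^ 2) * Complex.I_sq
  have h4 : toComplex y ^ 3 + (starRingEnd ℂ) (toComplex y) ^ 3
      = 2 * (y.1 ^ 3 - 3 * y.1 * y.2 ^ 2) := by
    rw [h2, h1]; linear_combination (6 * (y.1 : ℂ) * (y.2 : ℂ) ^ 2) * Complex.I_sq
  rw [h3, h4, K]
  push_cast
  ring

/-- The classical discriminant of a cubic with `e₁ = z`, `e₂ = conj z`, `e₃ = 1`. The roots are not
assumed to be unimodular, so this also serves to exclude points outside the image of `X`. -/
lemma ofReal_K_eq_neg_discr {y : ℝ × ℝ} {u v w : ℂ} (h₁ : toComplex y = u + v + w)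
    (h₂ : (starRingEnd ℂ) (toComplex y) = u * v + v * w + w * u) (h₃ : u * v * w = 1) :
    (K y : ℂ) = -((u - v) * (v - w) * (w - u)) ^ 2 := by
  have h : ((u - v) * (v - w) * (w - u)) ^ 2 =
      (u + v + w) ^ 2 * (u * v + v * w + w * u) ^ 2 - 4 * (u * v + v * w + w * u) ^ 3
      - 4 * (u + v + w) ^ 3 * (u * v * w)
      + 18 * (u + v + w) * (u * v + v * w + w * u) * (u * v * w) - 27 * (u * v * w) ^ 2 := by ring
  rw [ofReal_K, h₂, h₁, h, h₃]; ring

lemma S_eq_vandermonde (a : ℝ × ℝ) :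
    S (1, 1) a = (ex a.1 - ex (-a.2)) * (ex (-a.2) - ex (a.2 - a.1)) *
      (ex (a.2 - a.1) - ex a.1) := by
  have key : ∀ m n : ℤ, Complex.exp (2 * Real.pi * Complex.I * ((m : ℂ) * a.1 + (n : ℂ) * a.2))
      = ex (m * a.1 + n * a.2) := fun m n => by
    rw [ex]; congr 1; push_cast; ring
  have e1 : ex (((1:ℤ):ℝ) * a.1 + ((1:ℤ):ℝ) * a.2) = ex a.1 * ex a.1 * ex (a.2 - a.1) := by
    rw [← ex_add, ← ex_add]; congr 1; push_cast; ring
  have e2 : ex (((-1:ℤ):ℝ) * a.1 + ((1 + 1:ℤ):ℝ) * a.2)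
      = ex (a.2 - a.1) * ex (a.2 - a.1) * ex a.1 := by
    rw [← ex_add, ← ex_add]; congr 1; push_cast; ring
  have e3 : ex (((1 + 1:ℤ):ℝ) * a.1 + ((-1:ℤ):ℝ) * a.2) = ex a.1 * ex a.1 * ex (-a.2) := by
    rw [← ex_add, ← ex_add]; congr 1; push_cast; ring
  have e4 : ex (((1:ℤ):ℝ) * a.1 + ((-(1 + 1):ℤ):ℝ) * a.2) = ex (-a.2) * ex (-a.2) * ex a.1 := by
    rw [← ex_add, ← ex_add]; congr 1; push_cast; ring
  have e5 : ex (((-(1 + 1):ℤ):ℝ) * a.1 + ((1:ℤ):ℝ) * a.2)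
      = ex (a.2 - a.1) * ex (a.2 - a.1) * ex (-a.2) := by
    rw [← ex_add, ← ex_add]; congr 1; push_cast; ring
  have e6 : ex (((-1:ℤ):ℝ) * a.1 + ((-1:ℤ):ℝ) * a.2)
      = ex (-a.2) * ex (-a.2) * ex (a.2 - a.1) := by
    rw [← ex_add, ← ex_add]; congr 1; push_cast; ring
  simp only [S, key]
  rw [e1, e2, e3, e4, e5, e6]; ring

/-- The real function with `S_ρ = i · sinS`. -/
noncomputable def sinS (a : ℝ × ℝ) : ℝ :=
  2 * (Real.sin (2 * Real.pi * (a.1 + a.2)) - Real.sin (2 * Real.pi * (2 * a.1 - a.2))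
    - Real.sin (2 * Real.pi * (2 * a.2 - a.1)))

lemma S_eq_sinS_mul_I (a : ℝ × ℝ) : S (1, 1) a = sinS a * Complex.I := by
  have key : ∀ m n : ℤ, Complex.exp (2 * Real.pi * Complex.I * ((m : ℂ) * a.1 + (n : ℂ) * a.2))
      = ex (m * a.1 + n * a.2) := fun m n => by
    rw [ex]; congr 1; push_cast; ring
  have hneg : ∀ x : ℝ, 2 * Real.pi * -x = -(2 * Real.pi * x) := fun x => by ring
  have e2 : ((-1:ℤ):ℝ) * a.1 + ((1 + 1:ℤ):ℝ) * a.2 = 2 * a.2 - a.1 := by push_cast; ring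
  have e3 : ((1 + 1:ℤ):ℝ) * a.1 + ((-1:ℤ):ℝ) * a.2 = 2 * a.1 - a.2 := by push_cast; ring
  have e4 : ((1:ℤ):ℝ) * a.1 + ((-(1 + 1):ℤ):ℝ) * a.2 = -(2 * a.2 - a.1) := by push_cast; ring
  have e5 : ((-(1 + 1):ℤ):ℝ) * a.1 + ((1:ℤ):ℝ) * a.2 = -(2 * a.1 - a.2) := by push_cast; ring
  have e6 : ((-1:ℤ):ℝ) * a.1 + ((-1:ℤ):ℝ) * a.2 = -(a.1 + a.2) := by push_cast; ring
  have e1 : ((1:ℤ):ℝ) * a.1 + ((1:ℤ):ℝ) * a.2 = a.1 + a.2 := by push_cast; ring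
  simp only [S, key]
  rw [e1, e2, e3, e4, e5, e6]
  simp only [ex_eq_cos_sin, hneg, Real.cos_neg, Real.sin_neg, sinS]
  push_cast; ring

lemma K_X_eq_sinS_sq (a : ℝ × ℝ) : K (X a) = sinS a ^ 2 := by
  have h := ofReal_K_eq_neg_discr (toComplex_X a) (conj_toComplex_X a) (ex_prod_eq_one a)
  rw [← S_eq_vandermonde, S_eq_sinS_mul_I, mul_pow, Complex.I_sq] at h
  have : (K (X a) : ℂ) = ((sinS a ^ 2 : ℝ) : ℂ) := by rw [h]; push_cast; ring
  exact_mod_cast this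

lemma K_X_eq_norm_S_sq (a : ℝ × ℝ) : K (X a) = ‖S (1, 1) a‖ ^ 2 := by
  rw [K_X_eq_sinS_sq, S_eq_sinS_mul_I, norm_mul, Complex.norm_I, mul_one, Complex.norm_real,
    Real.norm_eq_abs, sq_abs]

/-! ### Weyl orbits in the torus. -/

lemma r₁_apply (a : ℝ × ℝ) : r₁ a = (-a.1 + a.2, a.2) := rfl

lemma r₂_apply (a : ℝ × ℝ) : r₂ a = (a.1, a.1 - a.2) := rfl

lemma r₁_inv : r₁⁻¹ = r₁ := rfl

lemma r₂_inv : r₂⁻¹ = r₂ := rfl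

/-- The list is stable under both generators. Its entries are the pairs `(x, -y)` with `x, y` in
different positions of the triple `a₁, -a₂, a₂ - a₁`: the group acts as `S₃` on that triple. -/
lemma apply_of_mem_weyl {w : (ℝ × ℝ) ≃ₗ[ℝ] (ℝ × ℝ)} (hw : w ∈ weyl) (a : ℝ × ℝ) :
    w a = (a.1, a.2) ∨ w a = (a.1, a.1 - a.2) ∨ w a = (-a.2, a.1 - a.2) ∨
      w a = (-a.2, -a.1) ∨ w a = (a.2 - a.1, a.2) ∨ w a = (a.2 - a.1, -a.1) := by
  have step₁ : ∀ b : ℝ × ℝ, (b = (a.1, a.2) ∨ b = (a.1, a.1 - a.2) ∨ b = (-a.2, a.1 - a.2) ∨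
      b = (-a.2, -a.1) ∨ b = (a.2 - a.1, a.2) ∨ b = (a.2 - a.1, -a.1)) →
      (r₁ b = (a.1, a.2) ∨ r₁ b = (a.1, a.1 - a.2) ∨ r₁ b = (-a.2, a.1 - a.2) ∨
      r₁ b = (-a.2, -a.1) ∨ r₁ b = (a.2 - a.1, a.2) ∨ r₁ b = (a.2 - a.1, -a.1)) := by
    rintro b (rfl | rfl | rfl | rfl | rfl | rfl)
    · right; right; right; right; left; simp [r₁_apply]; ring
    · right; right; left; simp [r₁_apply]; ring
    · right; left; simp [r₁_apply]
    · right; right; right; right; right; simp [r₁_apply]; ring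
    · left; simp [r₁_apply]
    · right; right; right; left; simp [r₁_apply]; ring
  have step₂ : ∀ b : ℝ × ℝ, (b = (a.1, a.2) ∨ b = (a.1, a.1 - a.2) ∨ b = (-a.2, a.1 - a.2) ∨
      b = (-a.2, -a.1) ∨ b = (a.2 - a.1, a.2) ∨ b = (a.2 - a.1, -a.1)) →
      (r₂ b = (a.1, a.2) ∨ r₂ b = (a.1, a.1 - a.2) ∨ r₂ b = (-a.2, a.1 - a.2) ∨
      r₂ b = (-a.2, -a.1) ∨ r₂ b = (a.2 - a.1, a.2) ∨ r₂ b = (a.2 - a.1, -a.1)) := by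
    rintro b (rfl | rfl | rfl | rfl | rfl | rfl)
    · right; left; simp [r₂_apply]
    · left; simp [r₂_apply]
    · right; right; right; left; simp [r₂_apply]; ring
    · right; right; left; simp [r₂_apply]; ring
    · right; right; right; right; right; simp [r₂_apply]
    · right; right; right; right; left; simp [r₂_apply]
  induction hw using Subgroup.closure_induction_left with
  | one => left; rfl
  | mul_left x hx y _ ih =>
    rcases hx with rfl | rfl
    · exact step₁ _ ih
    · exact step₂ _ ih
  | inv_mul_cancel x hx y _ ih =>
    rcases hx with rfl | rfl
    · rw [r₁_inv]; exact step₁ _ ih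
    · rw [r₂_inv]; exact step₂ _ ih

lemma r₁_mem_weyl : r₁ ∈ weyl := Subgroup.subset_closure (by simp)

lemma r₂_mem_weyl : r₂ ∈ weyl := Subgroup.subset_closure (by simp)

/-- The Weyl orbit in the torus, in terms of the three classes `a₁`, `-a₂`, `a₂ - a₁`. -/
lemma torusOrbit_eq (a : ℝ × ℝ) (x y z : UnitAddCircle) (hx : x = a.1) (hy : y = (-a.2 : ℝ))
    (hz : z = (a.2 - a.1 : ℝ)) :
    {t | ∃ w ∈ weyl, t = toTorus (w a)} =
      {(x, -y), (x, -z), (y, -z), (y, -x), (z, -y), (z, -x)} := by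
  subst hx hy hz
  ext t
  simp only [Set.mem_ofPred_eq, Set.mem_insert_iff, Set.mem_singleton_iff]
  constructor
  · rintro ⟨w, hw, rfl⟩
    rcases apply_of_mem_weyl hw a with h | h | h | h | h | h <;> rw [h] <;>
      simp [toTorus]
  · have h12 := weyl.mul_mem r₁_mem_weyl r₂_mem_weyl
    have h21 := weyl.mul_mem r₂_mem_weyl r₁_mem_weyl
    have h121 := weyl.mul_mem h12 r₁_mem_weyl
    rintro (rfl | rfl | rfl | rfl | rfl | rfl)
    · exact ⟨1, weyl.one_mem, by simp [toTorus]⟩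
    · exact ⟨r₂, r₂_mem_weyl, by simp [toTorus, r₂_apply]⟩
    · exact ⟨r₁ * r₂, h12, by simp [toTorus, r₁_apply, r₂_apply, LinearEquiv.mul_apply]; abel⟩
    · exact ⟨r₁ * r₂ * r₁, h121, by simp [toTorus, r₁_apply, r₂_apply, LinearEquiv.mul_apply]⟩
    · exact ⟨r₁, r₁_mem_weyl, by simp [toTorus, r₁_apply]; abel⟩
    · exact ⟨r₂ * r₁, h21, by simp [toTorus, r₁_apply, r₂_apply, LinearEquiv.mul_apply]; abel⟩

lemma ncard_orbit_of_distinct {G : Type*} [AddGroup G] {x y z : G} (hxy : x ≠ y) (hxz : x ≠ z)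
    (hyz : y ≠ z) :
    ({(x, -y), (x, -z), (y, -z), (y, -x), (z, -y), (z, -x)} : Set (G × G)).ncard = 6 := by
  rw [Set.ncard_insert_of_notMem, Set.ncard_insert_of_notMem, Set.ncard_insert_of_notMem,
    Set.ncard_insert_of_notMem, Set.ncard_pair] <;>
  simp [hxy, hxz, hyz, hxy.symm, hxz.symm, hyz.symm]

lemma ncard_orbit_of_eq {G : Type*} [AddGroup G] {x z : G} (hxz : x ≠ z) :
    ({(x, -x), (x, -z), (z, -x)} : Set (G × G)).ncard = 3 := by
  rw [Set.ncard_insert_of_notMem, Set.ncard_pair] <;> simp [hxz, hxz.symm]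

lemma coe_eq_coe_iff (x y : ℝ) : (x : UnitAddCircle) = y ↔ ∃ n : ℤ, x = y + n := by
  rw [← sub_eq_zero, ← AddCircle.coe_sub, AddCircle.coe_eq_zero_iff]
  refine exists_congr fun n => ?_
  rw [zsmul_eq_mul, mul_one, eq_sub_iff_add_eq, add_comm, eq_comm]

lemma coe_eq_coe_iff_ex (x y : ℝ) : (x : UnitAddCircle) = y ↔ ex x = ex y := by
  rw [coe_eq_coe_iff, ex_eq_ex_iff]

lemma exists_int_eq_div_iff {k M : ℕ} (hM : 0 < M) (hk : k ≤ M) :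
    (∃ n : ℤ, (k : ℝ) / M = n) ↔ k = 0 ∨ k = M := by
  have hM' : (M : ℝ) ≠ 0 := by exact_mod_cast hM.ne'
  constructor
  · rintro ⟨n, hn⟩
    rw [div_eq_iff hM'] at hn
    have h : (k : ℤ) = n * M := by exact_mod_cast hn
    have h0 : 0 ≤ n := by nlinarith
    have h1 : n ≤ 1 := by nlinarith
    interval_cases n <;> omega
  · rintro (rfl | rfl)
    · exact ⟨0, by simp⟩
    · exact ⟨1, by simp [hM']⟩

lemma mem_I {M : ℕ} {j : Fin 3 → ℕ} : j ∈ I M ↔ j 0 + j 1 + j 2 = M := by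
  rw [I, Finset.Nat.mem_antidiagonalTuple, Fin.sum_univ_three]

/-- The differences of the three classes are, up to sign and integers, `s₀/M`, `s₁/M`, `s₂/M`, so
two classes coincide exactly when the corresponding `sᵢ` is `0` or `M`. The orbit has 6, 3 or 1
points according as the classes are distinct, two coincide, or all do. -/
lemma orbitSize_gridPoint {M : ℕ} (hM : 0 < M) {j : Fin 3 → ℕ} (hj : j ∈ I M) :
    orbitSize (gridPoint M j) = eps j := by
  rw [mem_I] at hj
  have hM' : (M : ℝ) ≠ 0 := by exact_mod_cast hM.ne'
  obtain ⟨x, hx⟩ : ∃ x : UnitAddCircle, x = (gridPoint M j).1 := ⟨_, rfl⟩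
  obtain ⟨y, hy⟩ : ∃ y : UnitAddCircle, y = (-(gridPoint M j).2 : ℝ) := ⟨_, rfl⟩
  obtain ⟨z, hz⟩ : ∃ z : UnitAddCircle, z = ((gridPoint M j).2 - (gridPoint M j).1 : ℝ) :=
    ⟨_, rfl⟩
  have hxy : x = y ↔ (j 1 + j 2 = 0 ∨ j 1 + j 2 = M) := by
    rw [hx, hy, coe_eq_coe_iff, ← exists_int_eq_div_iff hM (by omega)]
    refine exists_congr fun n => ?_
    rw [neg_add_eq_sub, eq_sub_iff_add_eq]
    have : (gridPoint M j).1 + (gridPoint M j).2 = ((j 1 + j 2 : ℕ) : ℝ) / M := by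
      simp only [gridPoint]; push_cast; field_simp; ring
    rw [this]
  have hxz : x = z ↔ (j 1 = 0 ∨ j 1 = M) := by
    rw [hx, hz, coe_eq_coe_iff, ← exists_int_eq_div_iff hM (by omega)]
    refine exists_congr fun n => ?_
    rw [← sub_eq_iff_eq_add']
    have : (gridPoint M j).1 - ((gridPoint M j).2 - (gridPoint M j).1) = (j 1 : ℝ) / M := by
      simp only [gridPoint]; field_simp; ring
    rw [this]
  have hzy : z = y ↔ (j 2 = 0 ∨ j 2 = M) := by
    rw [hz, hy, coe_eq_coe_iff, ← exists_int_eq_div_iff hM (by omega)]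
    refine exists_congr fun n => ?_
    rw [← sub_eq_iff_eq_add']
    have : (gridPoint M j).2 - (gridPoint M j).1 - -(gridPoint M j).2 = (j 2 : ℝ) / M := by
      simp only [gridPoint]; field_simp; ring
    rw [this]
  rw [orbitSize, torusOrbit_eq _ x y z hx hy hz]
  by_cases h1 : x = y
  · by_cases h2 : x = z
    · have : eps j = 1 := by rw [eps, if_pos]; have := hxy.1 h1; have := hxz.1 h2; omega
      rw [this, ← h1, ← h2]; simp
    · have : eps j = 3 := by
        have := hxy.1 h1; have := mt hxz.2 h2
        rw [eps, if_neg, if_pos] <;> omega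
      rw [this, ← ncard_orbit_of_eq h2, ← h1]
      congr 1; ext t; simp only [Set.mem_insert_iff, Set.mem_singleton_iff]; tauto
  · by_cases h2 : x = z
    · have : eps j = 3 := by
        have := hxz.1 h2; have := mt hxy.2 h1
        rw [eps, if_neg, if_pos] <;> omega
      rw [this, ← ncard_orbit_of_eq h1, ← h2]
      congr 1; ext t; simp only [Set.mem_insert_iff, Set.mem_singleton_iff]; tauto
    · by_cases h3 : z = y
      · have : eps j = 3 := by
          have := hzy.1 h3; have := mt hxy.2 h1
          rw [eps, if_neg, if_pos] <;> omega
        rw [this, ← ncard_orbit_of_eq (Ne.symm h1), h3]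
        congr 1; ext t; simp only [Set.mem_insert_iff, Set.mem_singleton_iff]; tauto
      · have : eps j = 6 := by
          have := mt hxy.2 h1; have := mt hxz.2 h2; have := mt hzy.2 h3
          rw [eps, if_neg, if_neg] <;> omega
        rw [this, ncard_orbit_of_distinct h1 h2 (Ne.symm h3)]

/-! ### Fibres of `X` and injectivity on the fundamental triangle. -/

lemma ex_eq_of_X_eq {a b : ℝ × ℝ} (h : X b = X a) :
    (ex b.1 = ex a.1 ∧ ex (-b.2) = ex (-a.2)) ∨ (ex b.1 = ex a.1 ∧ ex (-b.2) = ex (a.2 - a.1)) ∨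
    (ex b.1 = ex (-a.2) ∧ ex (-b.2) = ex a.1) ∨
    (ex b.1 = ex (-a.2) ∧ ex (-b.2) = ex (a.2 - a.1)) ∨
    (ex b.1 = ex (a.2 - a.1) ∧ ex (-b.2) = ex a.1) ∨
    (ex b.1 = ex (a.2 - a.1) ∧ ex (-b.2) = ex (-a.2)) := by
  apply perm_of_esymm_eq (w' := ex (b.2 - b.1))
  · rw [← toComplex_X, ← toComplex_X, h]
  · rw [← conj_toComplex_X, ← conj_toComplex_X, h]
  · rw [ex_prod_eq_one, ex_prod_eq_one]

lemma toTorus_eq_iff (b : ℝ × ℝ) (x y : ℝ) :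
    toTorus b = ((x : UnitAddCircle), -(y : UnitAddCircle)) ↔ ex b.1 = ex x ∧ ex (-b.2) = ex y := by
  rw [toTorus, Prod.mk.injEq, coe_eq_coe_iff_ex, ← coe_eq_coe_iff_ex (-b.2), AddCircle.coe_neg,
    neg_eq_iff_eq_neg]

/-- Two points have the same image under `X` if and only if they are conjugate under the affine
Weyl group. -/
lemma X_eq_iff {a b : ℝ × ℝ} :
    X b = X a ↔ ∃ w ∈ weyl, toTorus b = toTorus (w a) := by
  change _ ↔ toTorus b ∈ {t | ∃ w ∈ weyl, t = toTorus (w a)}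
  rw [torusOrbit_eq a _ _ _ rfl rfl rfl]
  simp only [Set.mem_insert_iff, Set.mem_singleton_iff, toTorus_eq_iff]
  constructor
  · intro h
    have := ex_eq_of_X_eq h
    tauto
  · intro h
    have hb := ex_prod_eq_one b
    have ha := ex_prod_eq_one a
    have hne : ex b.1 * ex (-b.2) ≠ 0 := left_ne_zero_of_mul_eq_one hb
    apply toComplex_injective
    rw [toComplex_X, toComplex_X]
    rcases h with ⟨h1, h2⟩ | ⟨h1, h2⟩ | ⟨h1, h2⟩ | ⟨h1, h2⟩ | ⟨h1, h2⟩ | ⟨h1, h2⟩ <;>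
      rw [h1, h2] at hb hne ⊢
    · rw [mul_left_cancel₀ hne (hb.trans ha.symm)]
    · rw [mul_left_cancel₀ hne (hb.trans (by rw [← ha]; ring : 1 = _ * ex (-a.2)))]; ring
    · rw [mul_left_cancel₀ hne (hb.trans (by rw [← ha]; ring : 1 = _ * ex a.1))]; ring
    · rw [mul_left_cancel₀ hne (hb.trans (by rw [← ha]; ring : 1 = _ * ex (a.2 - a.1)))]; ring
    · rw [mul_left_cancel₀ hne (hb.trans (by rw [← ha]; ring : 1 = _ * ex a.1))]; ring
    · rw [mul_left_cancel₀ hne (hb.trans (by rw [← ha]; ring : 1 = _ * ex (-a.2)))]; ring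

lemma mem_F {a : ℝ × ℝ} : a ∈ F ↔ 0 ≤ 2 * a.1 - a.2 ∧ 0 ≤ 2 * a.2 - a.1 ∧ a.1 + a.2 ≤ 1 := by
  constructor
  · rintro ⟨u₀, u₁, u₂, h₀, h₁, h₂, h, rfl⟩
    simp only [coweight₁, coweight₂, Prod.smul_mk, Prod.mk_add_mk, smul_eq_mul]
    refine ⟨?_, ?_, ?_⟩ <;> linarith
  · rintro ⟨h₁, h₂, h₀⟩
    refine ⟨1 - (a.1 + a.2), 2 * a.1 - a.2, 2 * a.2 - a.1, by linarith, h₁, h₂, by ring, ?_⟩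
    ext <;> simp [coweight₁, coweight₂] <;> ring

lemma X_injOn_F : Set.InjOn X F := by
  intro b hb a ha h
  rw [mem_F] at ha hb
  obtain ⟨ha1, ha2, ha0⟩ := ha
  obtain ⟨hb1, hb2, hb0⟩ := hb
  have key := ex_eq_of_X_eq h
  simp only [ex_eq_ex_iff] at key
  rcases key with ⟨⟨m, hm⟩, n, hn⟩ | ⟨⟨m, hm⟩, n, hn⟩ | ⟨⟨m, hm⟩, n, hn⟩ | ⟨⟨m, hm⟩, n, hn⟩ |
    ⟨⟨m, hm⟩, n, hn⟩ | ⟨⟨m, hm⟩, n, hn⟩ <;>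
  -- The triangle is so small that the integer shifts lie in `{-1, 0, 1}`. In each remaining case
  -- the linear inequalities of `F` either are contradictory or force equality.
  · have m1 : -2 < m := by have : (-2 : ℝ) < m := by linarith
                           exact_mod_cast this
    have m2 : m < 2 := by have : (m : ℝ) < 2 := by linarith
                          exact_mod_cast this
    have n1 : -2 < n := by have : (-2 : ℝ) < n := by linarith
                           exact_mod_cast this
    have n2 : n < 2 := by have : (n : ℝ) < 2 := by linarith
                          exact_mod_cast this
    interval_cases m <;> interval_cases n <;> push_cast at hm hn <;>
      exact Prod.ext (by linarith) (by linarith)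

/-! ### Chart coordinates and reduction to the fundamental triangle. -/

/-- The point with `a₁ + a₂ = q.1` and `2 a₁ - a₂ = q.2`. In these coordinates the affine walls are
`q.1 ∈ ℤ`, `q.2 ∈ ℤ` and `q.1 - q.2 ∈ ℤ`. -/
noncomputable def chart (q : ℝ × ℝ) : ℝ × ℝ := ((q.1 + q.2) / 3, (2 * q.1 - q.2) / 3)

/-- The map `X` in the coordinates of `chart`. -/
noncomputable def Y (q : ℝ × ℝ) : ℝ × ℝ := X (chart q)

/-- The fundamental triangle `F` in the coordinates of `chart`. -/
def T : Set (ℝ × ℝ) := {q | 0 ≤ q.2 ∧ q.2 ≤ q.1 ∧ q.1 ≤ 1}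

lemma chart_injective : Function.Injective chart := fun q q' h => by
  simp only [chart, Prod.mk.injEq] at h
  exact Prod.ext (by linarith [h.1, h.2]) (by linarith [h.1, h.2])

lemma chart_inverse (a : ℝ × ℝ) : chart (a.1 + a.2, 2 * a.1 - a.2) = a := by
  ext <;> simp [chart] <;> ring

lemma chart_mem_F {q : ℝ × ℝ} : chart q ∈ F ↔ q ∈ T := by
  simp only [mem_F, T, chart, Set.mem_ofPred_eq]
  constructor
  · rintro ⟨h1, h2, h3⟩
    refine ⟨?_, ?_, ?_⟩ <;> linarith
  · rintro ⟨h1, h2, h3⟩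
    refine ⟨?_, ?_, ?_⟩ <;> linarith

lemma Y_image_T : Y '' T = X '' F := by
  ext y
  constructor
  · rintro ⟨q, hq, rfl⟩
    exact ⟨chart q, chart_mem_F.2 hq, rfl⟩
  · rintro ⟨a, ha, rfl⟩
    exact ⟨(a.1 + a.2, 2 * a.1 - a.2), chart_mem_F.1 (by rwa [chart_inverse]), by
      rw [Y, chart_inverse]⟩

lemma Y_injOn_T : Set.InjOn Y T := fun _ hq _ hq' h =>
  chart_injective (X_injOn_F (chart_mem_F.2 hq) (chart_mem_F.2 hq') h)

lemma Y_swap (s u : ℝ) : Y (u, s) = Y (s, u) := by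
  apply toComplex_injective
  simp only [Y, toComplex_X, chart]
  ring_nf

lemma Y_reflect (s u : ℝ) : Y (s - u, -u) = Y (s, u) := by
  apply toComplex_injective
  simp only [Y, toComplex_X, chart]
  ring_nf

lemma X_add_int (a : ℝ × ℝ) (m n : ℤ) : X (a.1 + m, a.2 + n) = X a := by
  apply toComplex_injective
  have h1 : ex (a.1 + m) = ex a.1 := (ex_eq_ex_iff _ _).2 ⟨m, rfl⟩
  have h2 : ex (-(a.2 + n)) = ex (-a.2) := (ex_eq_ex_iff _ _).2 ⟨-n, by push_cast; ring⟩
  have h3 : ex (a.2 + n - (a.1 + m)) = ex (a.2 - a.1) :=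
    (ex_eq_ex_iff _ _).2 ⟨n - m, by push_cast; ring⟩
  rw [toComplex_X, toComplex_X, h1, h2, h3]

lemma Y_translate (s u : ℝ) (m n : ℤ) : Y (s + m + n, u + 2 * m - n) = Y (s, u) := by
  rw [Y, Y, ← X_add_int (chart (s, u)) m n]
  congr 1
  ext <;> simp [chart] <;> ring

lemma Y_rot_lower (s u : ℝ) : Y (2 - u, s - u + 1) = Y (s, u) := by
  rw [Y_swap, ← Y_reflect s u, ← Y_translate (s - u) (-u) 1 0]
  congr 2 <;> push_cast <;> ring

lemma Y_rot_upper (s u : ℝ) : Y (1 - s, u - s - 1) = Y (s, u) := by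
  rw [← Y_translate s u 0 1, ← Y_swap, ← Y_rot_lower]
  congr 2 <;> push_cast <;> ring

lemma Y_rot_upper_swap (s u : ℝ) : Y (u - s - 1, 1 - s) = Y (s, u) := by
  rw [Y_swap, Y_rot_upper]

lemma Y_reflect_three (s u : ℝ) : Y (s - u + 3, 3 - u) = Y (s, u) := by
  rw [← Y_reflect s u, ← Y_translate (s - u) (-u) 2 1]
  congr 2 <;> push_cast <;> ring

/-- Every point is conjugate under the affine Weyl group to one of the fundamental triangle, by an
affine map with integer coefficients. -/
lemma exists_mem_T_Y_eq (q : ℝ × ℝ) :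
    ∃ q' ∈ T, Y q' = Y q ∧ ∀ H : AddSubgroup ℝ, 1 ∈ H → q.1 ∈ H → q.2 ∈ H →
      q'.1 ∈ H ∧ q'.2 ∈ H := by
  have main : ∀ s u : ℝ, 0 ≤ s → s ≤ 1 → 0 ≤ u → u ≤ 3 →
      ∃ q' ∈ T, Y q' = Y (s, u) ∧ ∀ H : AddSubgroup ℝ, 1 ∈ H → s ∈ H → u ∈ H →
        q'.1 ∈ H ∧ q'.2 ∈ H := by
    intro s u hs0 hs1 hu0 hu3
    have two : ∀ H : AddSubgroup ℝ, 1 ∈ H → (2 : ℝ) ∈ H := fun H h => by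
      rw [← one_add_one_eq_two]; exact H.add_mem h h
    have three : ∀ H : AddSubgroup ℝ, 1 ∈ H → (3 : ℝ) ∈ H := fun H h => by
      rw [← two_add_one_eq_three]; exact H.add_mem (two H h) h
    -- The walls `u = s, 1, 1 + s, 2, 2 + s` cut the strip into six triangles, each carried onto `T`
    -- by one of the symmetries above.
    rcases le_total u 1 with h1 | h1
    · rcases le_total u s with h | h
      · exact ⟨(s, u), ⟨hu0, h, hs1⟩, rfl, fun H _ hs hu => ⟨hs, hu⟩⟩
      · exact ⟨(u, s), ⟨hs0, h, h1⟩, Y_swap s u, fun H _ hs hu => ⟨hu, hs⟩⟩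
    rcases le_total u 2 with h2 | h2
    · rcases le_total u (1 + s) with h | h
      · refine ⟨(2 - u, s - u + 1), ⟨?_, ?_, ?_⟩, Y_rot_lower s u, fun H h1 hs hu =>
          ⟨H.sub_mem (two H h1) hu, H.add_mem (H.sub_mem hs hu) h1⟩⟩ <;> dsimp only <;> linarith
      · refine ⟨(1 - s, u - s - 1), ⟨?_, ?_, ?_⟩, Y_rot_upper s u, fun H h1 hs hu =>
          ⟨H.sub_mem h1 hs, H.sub_mem (H.sub_mem hu hs) h1⟩⟩ <;> dsimp only <;> linarith
    · rcases le_total u (2 + s) with h | h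
      · refine ⟨(u - s - 1, 1 - s), ⟨?_, ?_, ?_⟩, Y_rot_upper_swap s u, fun H h1 hs hu =>
          ⟨H.sub_mem (H.sub_mem hu hs) h1, H.sub_mem h1 hs⟩⟩ <;> dsimp only <;> linarith
      · refine ⟨(s - u + 3, 3 - u), ⟨?_, ?_, ?_⟩, Y_reflect_three s u, fun H h1 hs hu =>
          ⟨H.add_mem (H.sub_mem hs hu) (three H h1), H.sub_mem (three H h1) hu⟩⟩ <;>
          dsimp only <;> linarith
  obtain ⟨s, u⟩ := q
  -- In the chart the coroot lattice is generated by `(1, -1)` and `(0, 3)`: reducing `s` modulo 1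
  -- adds `⌊s⌋` to `u`, which is then reduced modulo 3.
  set n : ℤ := ⌊(u + ⌊s⌋) / 3⌋ with hn
  have hn1 := Int.floor_le ((u + ⌊s⌋) / 3)
  have hn2 := Int.lt_floor_add_one ((u + ⌊s⌋) / 3)
  rw [← hn] at hn1 hn2
  obtain ⟨q', hq', hY, hH⟩ := main (s - ⌊s⌋) (u + ⌊s⌋ - 3 * n) (by linarith [Int.floor_le s])
    (by linarith [Int.lt_floor_add_one s]) (by linarith) (by linarith)
  refine ⟨q', hq', ?_, fun H h1 hs hu => hH H h1 ?_ ?_⟩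
  · rw [hY, ← Y_translate s u (-n) (n - ⌊s⌋)]
    congr 2 <;> push_cast <;> ring
  · have : (⌊s⌋ : ℝ) ∈ H := by simpa using H.zsmul_mem h1 ⌊s⌋
    exact H.sub_mem hs this
  · have h3 : (⌊s⌋ : ℝ) ∈ H := by simpa using H.zsmul_mem h1 ⌊s⌋
    have h4 : (3 * n : ℝ) ∈ H := by simpa using H.zsmul_mem h1 (3 * n)
    exact H.sub_mem (H.add_mem hu h3) h4

/-! ### The image of `X` is the region `K ≥ 0`. -/

/-- Inversion in the unit circle swaps `u` and `v` and fixes `w`. Together with `uvw = 1` this makes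
the Vandermonde product real, and it is nonzero because `u` and `v` lie on opposite sides of the
circle while `w` lies on it. -/
lemma K_neg_of_conj_mul_eq_one {y : ℝ × ℝ} {u v w : ℂ} (h₁ : toComplex y = u + v + w)
    (h₂ : (starRingEnd ℂ) (toComplex y) = u * v + v * w + w * u) (h₃ : u * v * w = 1)
    (hu : ‖u‖ ≠ 1) (huv : (starRingEnd ℂ) u * v = 1) : K y < 0 := by
  have hu0 : u ≠ 0 := by rintro rfl; simp at h₃
  have hv0 : v ≠ 0 := by rintro rfl; simp at h₃
  have hw0 : w ≠ 0 := by rintro rfl; simp at h₃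
  have cu : (starRingEnd ℂ) u = v⁻¹ := eq_inv_of_mul_eq_one_left huv
  have cv : (starRingEnd ℂ) v = u⁻¹ := by
    apply eq_inv_of_mul_eq_one_left
    simpa [mul_comm] using congrArg (starRingEnd ℂ) huv
  have cw : (starRingEnd ℂ) w = w⁻¹ := by
    have hw : w = u⁻¹ * v⁻¹ := by field_simp; linear_combination h₃
    rw [hw, map_mul, map_inv₀, map_inv₀, cu, cv]; field_simp
  have nuv : ‖u‖ * ‖v‖ = 1 := by
    simpa using congrArg norm huv
  have nw : ‖w‖ = 1 := by
    have := congrArg norm h₃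
    simpa [nuv] using this
  have nv : ‖v‖ ≠ 1 := fun h => hu (by rw [h, mul_one] at nuv; exact nuv)
  have hne : (u - v) * (v - w) * (w - u) ≠ 0 := by
    refine mul_ne_zero (mul_ne_zero ?_ ?_) ?_ <;> rw [sub_ne_zero]
    · rintro rfl
      exact hu ((mul_self_eq_one_iff.1 nuv).resolve_right (by linarith [norm_nonneg u]))
    · rintro rfl; exact nv nw
    · rintro rfl; exact hu nw
  have hreal : (starRingEnd ℂ) ((u - v) * (v - w) * (w - u)) = (u - v) * (v - w) * (w - u) := by
    have : (starRingEnd ℂ) ((u - v) * (v - w) * (w - u)) * (u * v * w) ^ 2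
        = (u - v) * (v - w) * (w - u) := by
      simp only [map_mul, map_sub, cu, cv, cw]; field_simp
    simpa [h₃] using this
  obtain ⟨r, hr⟩ := Complex.conj_eq_iff_real.1 hreal
  have hK := ofReal_K_eq_neg_discr h₁ h₂ h₃
  rw [hr] at hK hne
  have hK' : K y = -r ^ 2 := by exact_mod_cast hK
  have hr0 : r ≠ 0 := by exact_mod_cast hne
  rw [hK']
  linarith [sq_pos_of_ne_zero hr0]

/-- The cubic is self-inversive, so `t = 1 / conj u` is again a root. If `t = u`, then `u` is
unimodular; if `t` is `v` or `w` and `u` is not unimodular, then `K < 0`. -/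
lemma norm_eq_one_of_K_nonneg {y : ℝ × ℝ} {u v w : ℂ} (h₁ : toComplex y = u + v + w)
    (h₂ : (starRingEnd ℂ) (toComplex y) = u * v + v * w + w * u) (h₃ : u * v * w = 1)
    (hK : 0 ≤ K y) : ‖u‖ = 1 := by
  by_contra hu
  have hu0 : u ≠ 0 := by rintro rfl; simp at h₃
  obtain ⟨t, ht⟩ : ∃ t, (starRingEnd ℂ) u * t = 1 :=
    ⟨_, mul_inv_cancel₀ ((map_ne_zero _).2 hu0)⟩
  have c1 := congrArg (starRingEnd ℂ) h₂
  rw [Complex.conj_conj, h₁] at c1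
  have c2 : (starRingEnd ℂ) u + (starRingEnd ℂ) v + (starRingEnd ℂ) w = u * v + v * w + w * u := by
    rw [← map_add, ← map_add, ← h₁, h₂]
  have c3 := congrArg (starRingEnd ℂ) h₃
  simp only [map_add, map_mul, map_one] at c1 c3
  have root : (t - u) * ((t - v) * (t - w)) = 0 := by
    generalize (starRingEnd ℂ) u = u' at *
    generalize (starRingEnd ℂ) v = v' at *
    generalize (starRingEnd ℂ) w = w' at *
    -- Clearing denominators with `u' t = 1` turns the cubic at `t` into the conjugate cubic at its
    -- root `u'`.
    have e : u' ^ 3 * ((t - u) * ((t - v) * (t - w))) = 0 := by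
      have e1 : u' ^ 3 * ((t - u) * ((t - v) * (t - w))) =
          (u' * t) ^ 3 - (u' * t) ^ 2 * (u' * (u + v + w)) +
          (u' * t) * (u' ^ 2 * (u * v + v * w + w * u)) - u' ^ 3 * (u * v * w) := by ring
      rw [e1, ht, c1, ← c2, h₃]
      linear_combination -c3
    have hu' : u' ≠ 0 := left_ne_zero_of_mul_eq_one ht
    exact (mul_eq_zero.1 e).resolve_left (pow_ne_zero _ hu')
  simp only [mul_eq_zero, sub_eq_zero] at root
  rcases root with rfl | rfl | rfl
  · have : ‖t‖ * ‖t‖ = 1 := by simpa using congrArg norm ht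
    exact hu ((mul_self_eq_one_iff.1 this).resolve_right (by linarith [norm_nonneg t]))
  · exact absurd (K_neg_of_conj_mul_eq_one h₁ h₂ h₃ hu ht) (not_lt.2 hK)
  · exact absurd (K_neg_of_conj_mul_eq_one (w := v) (by rw [h₁]; ring) (by rw [h₂]; ring)
      (by rw [← h₃]; ring) hu ht) (not_lt.2 hK)

lemma exists_esymm_eq (z z' : ℂ) :
    ∃ u v w : ℂ, z = u + v + w ∧ z' = u * v + v * w + w * u ∧ u * v * w = 1 := by
  obtain ⟨u, hu⟩ := IsAlgClosed.exists_root
    (Polynomial.C 1 * Polynomial.X ^ 3 + Polynomial.C (-z) * Polynomial.X ^ 2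
      + Polynomial.C z' * Polynomial.X + Polynomial.C (-1) : Polynomial ℂ)
    (by rw [Polynomial.degree_cubic one_ne_zero]; decide)
  -- The quotient of the cubic by `X - u`.
  obtain ⟨v, hv⟩ := IsAlgClosed.exists_root
    (Polynomial.C 1 * Polynomial.X ^ 2 + Polynomial.C (u - z) * Polynomial.X
      + Polynomial.C (u ^ 2 - z * u + z') : Polynomial ℂ)
    (by rw [Polynomial.degree_quadratic one_ne_zero]; decide)
  simp only [Polynomial.IsRoot.def, Polynomial.eval_add, Polynomial.eval_mul, Polynomial.eval_C,
    Polynomial.eval_pow, Polynomial.eval_X] at hu hv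
  refine ⟨u, v, z - u - v, by ring, by linear_combination hv, ?_⟩
  linear_combination hu - u * hv

lemma Omega_eq_image : Omega = X '' F := by
  ext y
  constructor
  · intro hy
    obtain ⟨u, v, w, h₁, h₂, h₃⟩ := exists_esymm_eq (toComplex y) ((starRingEnd ℂ) (toComplex y))
    have nu := norm_eq_one_of_K_nonneg h₁ h₂ h₃ hy
    have nv := norm_eq_one_of_K_nonneg (u := v) (v := w) (w := u) (by rw [h₁]; ring)
      (by rw [h₂]; ring) (by rw [← h₃]; ring) hy
    obtain ⟨x, rfl⟩ := exists_eq_ex nu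
    obtain ⟨t, rfl⟩ := exists_eq_ex nv
    have hw : w = ex (-t - x) := by
      have : ex x * ex t * ex (-t - x) = 1 := by
        rw [← ex_add, ← ex_add, ← ex_zero]; congr 1; ring
      exact mul_left_cancel₀ (left_ne_zero_of_mul_eq_one h₃) (h₃.trans this.symm)
    have hX : X (x, -t) = y := by
      apply toComplex_injective
      rw [toComplex_X, h₁, hw, neg_neg]
    obtain ⟨q', hq', hY, -⟩ := exists_mem_T_Y_eq (x + -t, 2 * x - -t)
    refine ⟨chart q', chart_mem_F.2 hq', ?_⟩
    rw [← hX]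
    refine hY.trans ?_
    rw [Y]
    congr 1
    exact chart_inverse (x, -t)
  · rintro ⟨a, -, rfl⟩
    change 0 ≤ K (X a)
    rw [K_X_eq_sinS_sq]
    positivity

/-! ### Lattice points, nodes and multiplicities. -/

lemma gridPoint_eq_chart {M : ℕ} (hM : 0 < M) (j : Fin 3 → ℕ) :
    gridPoint M j = chart (((j 1 : ℝ) + j 2) / M, (j 1 : ℝ) / M) := by
  have hM' : (M : ℝ) ≠ 0 := by exact_mod_cast hM.ne'
  simp only [gridPoint, chart]
  ext <;> field_simp <;> ring

lemma gridPoint_mem_F {M : ℕ} (hM : 0 < M) {j : Fin 3 → ℕ} (hj : j ∈ I M) :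
    gridPoint M j ∈ F := by
  rw [mem_I] at hj
  have hM' : (0 : ℝ) < M := by exact_mod_cast hM
  have hj' : (j 0 : ℝ) + j 1 + j 2 = M := by exact_mod_cast hj
  rw [gridPoint_eq_chart hM, chart_mem_F]
  refine ⟨by positivity, ?_, ?_⟩
  · dsimp only
    gcongr
    linarith [(j 2).cast_nonneg (α := ℝ)]
  · dsimp only
    rw [div_le_one hM']
    linarith [(j 0).cast_nonneg (α := ℝ)]

lemma node_injOn {M : ℕ} (hM : 0 < M) : Set.InjOn (node M) (I M) := by
  intro j hj j' hj' h
  have hg := X_injOn_F (gridPoint_mem_F hM hj) (gridPoint_mem_F hM hj') h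
  rw [gridPoint_eq_chart hM, gridPoint_eq_chart hM] at hg
  have hM' : (M : ℝ) ≠ 0 := by exact_mod_cast hM.ne'
  have hq := chart_injective hg
  simp only [Prod.mk.injEq, div_left_inj' hM'] at hq
  have h1 : j 1 = j' 1 := by exact_mod_cast hq.2
  have h2 : j 1 + j 2 = j' 1 + j' 2 := by exact_mod_cast hq.1
  have e := mem_I.1 hj
  have e' := mem_I.1 hj'
  ext i
  fin_cases i
  · change j 0 = j' 0; omega
  · exact h1
  · change j 2 = j' 2; omega

/-- The points of the refined coweight lattice `P^∨ / M`, in the coordinates of `chart`. -/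
noncomputable def latticePoint (M : ℕ) (m n : ℤ) : ℝ × ℝ := ((m : ℝ) / M, (n : ℝ) / M)

lemma exists_node_eq {M : ℕ} (hM : 0 < M) (m n : ℤ) :
    ∃ j ∈ I M, node M j = Y (latticePoint M m n) := by
  have hM' : (0 : ℝ) < M := by exact_mod_cast hM
  have hmem : ∀ x : ℝ, x ∈ AddSubgroup.zmultiples ((1 : ℝ) / M) ↔ ∃ k : ℤ, x = k / M := by
    intro x
    rw [AddSubgroup.mem_zmultiples_iff]
    refine exists_congr fun k => ?_
    rw [zsmul_eq_mul, mul_one_div, eq_comm]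
  obtain ⟨q, ⟨hq0, hq1, hq2⟩, hY, hH⟩ := exists_mem_T_Y_eq (latticePoint M m n)
  -- The reduction to `T` has integer coefficients, so it preserves the subgroup `(1/M)ℤ`.
  obtain ⟨h1, h2⟩ := hH (AddSubgroup.zmultiples ((1 : ℝ) / M))
    ((hmem _).2 ⟨M, by simp [hM'.ne']⟩) ((hmem _).2 ⟨m, rfl⟩) ((hmem _).2 ⟨n, rfl⟩)
  obtain ⟨k, hk⟩ := (hmem _).1 h1
  obtain ⟨l, hl⟩ := (hmem _).1 h2
  rw [hl] at hq0 hq1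
  rw [hk] at hq1 hq2
  have l0 : 0 ≤ l := by
    have : (0 : ℝ) ≤ l := by simpa using (le_div_iff₀ hM').1 hq0
    exact_mod_cast this
  have lk : l ≤ k := by
    have : (l : ℝ) ≤ k := (div_le_div_iff_of_pos_right hM').1 hq1
    exact_mod_cast this
  have kM : k ≤ M := by
    have : (k : ℝ) ≤ M := (div_le_one hM').1 hq2
    exact_mod_cast this
  lift l to ℕ using l0
  lift k to ℕ using (by omega)
  refine ⟨![M - k, l, k - l], mem_I.2 (by simp; omega), ?_⟩
  rw [← hY, node, gridPoint_eq_chart hM, Y]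
  congr 2
  have : ((k - l : ℕ) : ℝ) = k - l := by push_cast [Nat.cast_sub (show l ≤ k by omega)]; ring
  ext
  · simp [hk, this]
  · simp [hl]

/-- Representatives of the refined coweight lattice modulo the coroot lattice. -/
def box (M : ℕ) : Finset (ℕ × ℕ) := Finset.range M ×ˢ Finset.range (3 * M)

lemma toTorus_latticePoint_injOn {M : ℕ} (hM : 0 < M) :
    Set.InjOn (fun c : ℕ × ℕ => toTorus (chart (latticePoint M c.1 c.2))) (box M) := by
  rintro ⟨m, n⟩ hc ⟨m', n'⟩ hc' h
  simp only [box, Finset.coe_product, Finset.coe_range, Set.mem_prod, Set.mem_Iio] at hc hc'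
  have hM' : (M : ℝ) ≠ 0 := by exact_mod_cast hM.ne'
  simp only [toTorus, Prod.mk.injEq, coe_eq_coe_iff] at h
  obtain ⟨⟨i, hi⟩, k, hk⟩ := h
  simp only [chart, latticePoint] at hi hk
  field_simp at hi hk
  have e1 : (m : ℤ) = m' + M * (i + k) := by
    have : (m : ℝ) = m' + M * (i + k) := by push_cast at hi hk; linarith
    exact_mod_cast this
  have e2 : (n : ℤ) = n' + M * (2 * i - k) := by
    have : (n : ℝ) = n' + M * (2 * i - k) := by push_cast at hi hk; linarith
    exact_mod_cast this
  -- `|m - m'| < M` forces `i + k = 0`; then `n - n' = 3Mi` with `|n - n'| < 3M` forces `i = 0`.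
  have s1 : i + k < 1 := by by_contra hcon; nlinarith
  have s2 : -1 < i + k := by by_contra hcon; nlinarith
  obtain rfl : k = -i := by omega
  have s3 : i < 1 := by by_contra hcon; nlinarith
  have s4 : -1 < i := by by_contra hcon; nlinarith
  obtain rfl : i = 0 := by omega
  simp only [Prod.mk.injEq]
  constructor <;> simp at e1 e2 <;> omega

lemma exists_box_toTorus_eq {M : ℕ} (hM : 0 < M) (m n : ℤ) :
    ∃ c ∈ box M, toTorus (chart (latticePoint M c.1 c.2)) = toTorus (chart (latticePoint M m n)) := by
  have hM' : (M : ℝ) ≠ 0 := by exact_mod_cast hM.ne'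
  have hMz : (0 : ℤ) < M := by exact_mod_cast hM
  -- Translation by `-k(1, -1)` brings `m` into range and adds `Mk` to `n`, which is then reduced
  -- modulo `3M`.
  set k := m / M with hk
  set l := (n + M * k) / (3 * M) with hl
  have em := Int.emod_add_mul_ediv m M
  have en := Int.emod_add_mul_ediv (n + M * k) (3 * M)
  rw [← hk] at em
  rw [← hl] at en
  have m0 := Int.emod_nonneg m hMz.ne'
  have m1 := Int.emod_lt_of_pos m hMz
  have n0 := Int.emod_nonneg (n + M * k) (show (3 * M : ℤ) ≠ 0 by omega)
  have n1 := Int.emod_lt_of_pos (n + M * k) (show (0 : ℤ) < 3 * M by omega)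
  generalize m % (M : ℤ) = a at *
  generalize (n + M * k) % (3 * M : ℤ) = b at *
  lift a to ℕ using m0
  lift b to ℕ using n0
  refine ⟨(a, b), by simp only [box, Finset.mem_product, Finset.mem_range]; omega, ?_⟩
  have em' : (m : ℝ) = a + M * k := by exact_mod_cast em.symm
  have en' : (n : ℝ) = b + 3 * M * l - M * k := by
    have : (b : ℝ) + 3 * M * l = n + M * k := by exact_mod_cast en
    linarith
  simp only [toTorus, Prod.mk.injEq, coe_eq_coe_iff]
  refine ⟨⟨-l, ?_⟩, ⟨l - k, ?_⟩⟩ <;> simp only [chart, latticePoint] <;>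
    rw [em', en'] <;> push_cast <;> field_simp <;> ring

lemma exists_latticePoint_of_mem_weyl {M : ℕ} (hM : 0 < M) (j : Fin 3 → ℕ)
    {w : (ℝ × ℝ) ≃ₗ[ℝ] (ℝ × ℝ)} (hw : w ∈ weyl) :
    ∃ m n : ℤ, w (gridPoint M j) = chart (latticePoint M m n) := by
  have hM' : (M : ℝ) ≠ 0 := by exact_mod_cast hM.ne'
  rcases apply_of_mem_weyl hw (gridPoint M j) with h | h | h | h | h | h <;> rw [h]
  · refine ⟨j 1 + j 2, j 1, ?_⟩
    simp only [gridPoint, chart, latticePoint]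
    ext <;> push_cast <;> field_simp <;> ring
  · refine ⟨j 1, j 1 + j 2, ?_⟩
    simp only [gridPoint, chart, latticePoint]
    ext <;> push_cast <;> field_simp <;> ring
  · refine ⟨-j 2, -j 1 - j 2, ?_⟩
    simp only [gridPoint, chart, latticePoint]
    ext <;> push_cast <;> field_simp <;> ring
  · refine ⟨-j 1 - j 2, -j 2, ?_⟩
    simp only [gridPoint, chart, latticePoint]
    ext <;> push_cast <;> field_simp <;> ring
  · refine ⟨j 2, -j 1, ?_⟩
    simp only [gridPoint, chart, latticePoint]
    ext <;> push_cast <;> field_simp <;> ring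
  · refine ⟨-j 1, j 2, ?_⟩
    simp only [gridPoint, chart, latticePoint]
    ext <;> push_cast <;> field_simp <;> ring

-- The box represents `P^∨/M` modulo `Q^∨`, which is Weyl-stable, so its points over a given node
-- correspond bijectively to the torus orbit of the grid point.
open Classical in
lemma card_box_filter_Y_eq_node {M : ℕ} (hM : 0 < M) {j : Fin 3 → ℕ} (hj : j ∈ I M) :
    ((box M).filter fun c => Y (latticePoint M c.1 c.2) = node M j).card = eps j := by
  rw [← orbitSize_gridPoint hM hj, orbitSize, ← Set.ncard_coe_finset]
  refine Set.ncard_congr (fun c _ => toTorus (chart (latticePoint M c.1 c.2))) ?_ ?_ ?_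
  · intro c hc
    simp only [Finset.coe_filter, Set.mem_ofPred_eq] at hc
    exact X_eq_iff.1 hc.2
  · intro c c' hc hc' h
    simp only [Finset.coe_filter, Set.mem_ofPred_eq] at hc hc'
    exact toTorus_latticePoint_injOn hM hc.1 hc'.1 h
  · rintro t ⟨w, hw, rfl⟩
    obtain ⟨m, n, hmn⟩ := exists_latticePoint_of_mem_weyl hM j hw
    obtain ⟨c, hc, hct⟩ := exists_box_toTorus_eq hM m n
    rw [← hmn] at hct
    refine ⟨c, ?_, hct⟩
    simp only [Finset.coe_filter, Set.mem_ofPred_eq]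
    exact ⟨hc, X_eq_iff.2 ⟨w, hw, hct⟩⟩

lemma sum_box_eq_sum_I {M : ℕ} (hM : 0 < M) (g : ℝ × ℝ → ℂ) :
    ∑ c ∈ box M, g (Y (latticePoint M c.1 c.2)) = ∑ j ∈ I M, (eps j : ℂ) * g (node M j) := by
  classical
  rw [← Finset.sum_fiberwise_of_maps_to (t := (I M).image (node M))
    (g := fun c : ℕ × ℕ => Y (latticePoint M c.1 c.2)), Finset.sum_image (node_injOn hM)]
  · refine Finset.sum_congr rfl fun j hj => ?_
    rw [← card_box_filter_Y_eq_node hM hj, ← nsmul_eq_mul, ← Finset.sum_const]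
    refine Finset.sum_congr (by simp) fun c hc => ?_
    rw [(Finset.mem_filter.1 hc).2]
  · intro c _
    obtain ⟨j, hj, h⟩ := exists_node_eq hM c.1 c.2
    exact Finset.mem_image.2 ⟨j, hj, h⟩

/-! ### Trigonometric polynomials with frequencies in a hexagon. -/

/-- The exponential function attached to a weight. -/
noncomputable def expFun (l : ℤ × ℤ) (a : ℝ × ℝ) : ℂ := ex (l.1 * a.1 + l.2 * a.2)

/-- The weights in the `N`-fold dilate of the hexagon spanned by the orbits of the fundamental
weights. -/
def hexagon (N : ℕ) : Set (ℤ × ℤ) := {l | |l.1| ≤ N ∧ |l.2| ≤ N ∧ |l.1 + l.2| ≤ N}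

/-- Trigonometric polynomials with frequencies in `hexagon N`. -/
noncomputable def trigPoly (N : ℕ) : Submodule ℂ (ℝ × ℝ → ℂ) :=
  Submodule.span ℂ (expFun '' hexagon N)

lemma expFun_mul (l l' : ℤ × ℤ) : expFun l * expFun l' = expFun (l + l') := by
  ext a
  simp only [expFun, Pi.mul_apply, ← ex_add, Prod.fst_add, Prod.snd_add]
  congr 1; push_cast; ring

lemma expFun_mem {N : ℕ} {l : ℤ × ℤ} (hl : l ∈ hexagon N) : expFun l ∈ trigPoly N :=
  Submodule.subset_span ⟨l, hl, rfl⟩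

lemma trigPoly_mono {m n : ℕ} (h : m ≤ n) : trigPoly m ≤ trigPoly n := by
  apply Submodule.span_mono
  apply Set.image_mono
  rintro l ⟨h1, h2, h3⟩
  have : (m : ℤ) ≤ n := by exact_mod_cast h
  exact ⟨h1.trans this, h2.trans this, h3.trans this⟩

lemma mul_mem_trigPoly {m n : ℕ} {f g : ℝ × ℝ → ℂ} (hf : f ∈ trigPoly m) (hg : g ∈ trigPoly n) :
    f * g ∈ trigPoly (m + n) := by
  have h := Submodule.mul_mem_mul hf hg
  rw [trigPoly, trigPoly, Submodule.span_mul_span] at h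
  refine Submodule.span_le.2 ?_ h
  rintro _ ⟨_, ⟨l, ⟨h1, h2, h3⟩, rfl⟩, _, ⟨l', ⟨h1', h2', h3'⟩, rfl⟩, rfl⟩
  change expFun l * expFun l' ∈ trigPoly (m + n)
  rw [expFun_mul]
  apply expFun_mem
  rw [abs_le] at h1 h2 h3 h1' h2' h3'
  refine ⟨?_, ?_, ?_⟩ <;> rw [abs_le] <;> simp only [Prod.fst_add, Prod.snd_add] <;>
    push_cast <;> constructor <;> linarith

lemma pow_mem_trigPoly {f : ℝ × ℝ → ℂ} (hf : f ∈ trigPoly 1) (n : ℕ) : f ^ n ∈ trigPoly n := by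
  induction n with
  | zero =>
    have : (f ^ 0 : ℝ × ℝ → ℂ) = expFun 0 := by ext a; simp [expFun, ex_zero]
    rw [this]
    exact expFun_mem (by simp [hexagon])
  | succ n ih => rw [pow_succ]; exact mul_mem_trigPoly ih hf

lemma toComplex_X_mem : (fun a => toComplex (X a)) ∈ trigPoly 1 := by
  have : (fun a => toComplex (X a)) = expFun (1, 0) + expFun (0, -1) + expFun (-1, 1) := by
    ext a
    rw [toComplex_X]
    simp only [Pi.add_apply, expFun]
    congr <;> push_cast <;> ring
  rw [this]
  refine Submodule.add_mem _ (Submodule.add_mem _ ?_ ?_) ?_ <;> apply expFun_mem <;>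
    simp [hexagon]

lemma conj_toComplex_X_mem : (fun a => (starRingEnd ℂ) (toComplex (X a))) ∈ trigPoly 1 := by
  have : (fun a => (starRingEnd ℂ) (toComplex (X a)))
      = expFun (-1, 0) + expFun (0, 1) + expFun (1, -1) := by
    ext a
    rw [toComplex_X, map_add, map_add, conj_ex, conj_ex, conj_ex]
    simp only [Pi.add_apply, expFun]
    congr <;> push_cast <;> ring
  rw [this]
  refine Submodule.add_mem _ (Submodule.add_mem _ ?_ ?_) ?_ <;> apply expFun_mem <;>
    simp [hexagon]

lemma X_fst_mem : (fun a => ((X a).1 : ℂ)) ∈ trigPoly 1 := by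
  have : (fun a => ((X a).1 : ℂ)) = (1 / 2 : ℂ) • ((fun a => toComplex (X a))
      + fun a => (starRingEnd ℂ) (toComplex (X a))) := by
    ext a
    simp only [Pi.smul_apply, Pi.add_apply, Complex.add_conj, smul_eq_mul, toComplex]
    push_cast; ring
  rw [this]
  exact Submodule.smul_mem _ _ (Submodule.add_mem _ toComplex_X_mem conj_toComplex_X_mem)

lemma X_snd_mem : (fun a => ((X a).2 : ℂ)) ∈ trigPoly 1 := by
  have : (fun a => ((X a).2 : ℂ)) = (-Complex.I / 2 : ℂ) • ((fun a => toComplex (X a))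
      - fun a => (starRingEnd ℂ) (toComplex (X a))) := by
    ext a
    simp only [Pi.smul_apply, Pi.sub_apply, Complex.sub_conj, smul_eq_mul, toComplex]
    push_cast
    linear_combination (X a).2 * Complex.I_sq
  rw [this]
  exact Submodule.smul_mem _ _ (Submodule.sub_mem _ toComplex_X_mem conj_toComplex_X_mem)

lemma value_X_mem {N : ℕ} {p : MvPolynomial (Fin 2) ℂ} (hp : p ∈ Pi N) :
    (fun a => value p (X a)) ∈ trigPoly N := by
  have : (fun a => value p (X a)) = ∑ d ∈ p.support, p.coeff d •
      ((fun a => ((X a).1 : ℂ)) ^ d 0 * (fun a => ((X a).2 : ℂ)) ^ d 1) := by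
    ext a
    simp [value, MvPolynomial.eval_eq', Fin.prod_univ_two]
  rw [this]
  refine Submodule.sum_mem _ fun d hd => Submodule.smul_mem _ _ ?_
  have hdN : d 0 + d 1 ≤ N := by
    refine le_trans ?_ ((MvPolynomial.le_weightedTotalDegree dualMarks hd).trans hp)
    rw [Finsupp.weight_apply, Finsupp.sum_fintype _ _ (by simp)]
    simp [Fin.sum_univ_two, dualMarks]
  exact trigPoly_mono hdN
    (mul_mem_trigPoly (pow_mem_trigPoly X_fst_mem _) (pow_mem_trigPoly X_snd_mem _))

/-! ### Exactness of the lattice average. -/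

lemma continuous_ex : Continuous ex := by
  unfold ex; fun_prop

lemma continuous_expFun (l : ℤ × ℤ) : Continuous (expFun l) := by
  unfold expFun; exact continuous_ex.comp (by fun_prop)

lemma continuous_of_mem_trigPoly {N : ℕ} {f : ℝ × ℝ → ℂ} (hf : f ∈ trigPoly N) :
    Continuous f := by
  induction hf using Submodule.span_induction with
  | mem f hf => obtain ⟨l, -, rfl⟩ := hf; exact continuous_expFun l
  | zero => exact continuous_zero
  | add f g _ _ hf hg => exact hf.add hg
  | smul c f _ hf => exact hf.const_smul c

lemma continuous_chart : Continuous chart := by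
  unfold chart; fun_prop

lemma expFun_chart (l : ℤ × ℤ) (q : ℝ × ℝ) :
    expFun l (chart q) = ex ((l.1 + 2 * l.2) / 3 * q.1) * ex ((l.1 - l.2) / 3 * q.2) := by
  rw [expFun, ← ex_add]; congr 1; simp only [chart]; ring

lemma integral_ex_eq_zero {c b : ℝ} (hb : 0 ≤ b) (hc : c ≠ 0) (hcb : ∃ n : ℤ, c * b = n) :
    ∫ x in Set.Ioc 0 b, ex (c * x) = 0 := by
  rw [← intervalIntegral.integral_of_le hb]
  have hc' : (2 * Real.pi * c * Complex.I : ℂ) ≠ 0 := by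
    have : (Real.pi : ℂ) ≠ 0 := by exact_mod_cast Real.pi_ne_zero
    have : (c : ℂ) ≠ 0 := by exact_mod_cast hc
    simp_all
  have h : ∀ x : ℝ, ex (c * x) = Complex.exp (2 * Real.pi * c * Complex.I * x) := fun x => by
    rw [ex]; congr 1; push_cast; ring
  simp only [h]
  rw [integral_exp_mul_complex hc', ← h, ← h, (ex_eq_one_iff _).2 hcb, mul_zero, ex_zero]
  simp

/-- The domain of representatives of the plane modulo the coroot lattice, in the coordinates of
`chart`. -/
def cell : Set (ℝ × ℝ) := Set.Ioc 0 1 ×ˢ Set.Ioc 0 3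

lemma integral_expFun_chart (l : ℤ × ℤ) :
    ∫ q in cell, expFun l (chart q) = if l = 0 then 3 else 0 := by
  simp only [expFun_chart]
  rw [cell, Measure.volume_eq_prod, setIntegral_prod_mul (fun s => ex ((l.1 + 2 * l.2) / 3 * s))
    (fun u => ex ((l.1 - l.2) / 3 * u))]
  split_ifs with h
  · subst h; simp [ex_zero]
  · by_cases h1 : l.1 = l.2
    · have h2 : l.2 ≠ 0 := fun h2 => h (Prod.ext (h1.trans h2) h2)
      rw [integral_ex_eq_zero zero_le_one, zero_mul]
      · rw [h1]
        have : (l.2 : ℝ) ≠ 0 := by exact_mod_cast h2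
        intro h3
        apply this
        linarith
      · exact ⟨l.2, by rw [h1]; ring⟩
    · rw [mul_comm, integral_ex_eq_zero (by norm_num), zero_mul]
      · have : (l.1 : ℝ) - l.2 ≠ 0 := by rw [sub_ne_zero]; exact_mod_cast h1
        positivity
      · exact ⟨l.1 - l.2, by push_cast; ring⟩

lemma sum_ex_eq_zero {n : ℕ} {x : ℝ} (h : ¬ ∃ k : ℤ, x = k) (hn : ∃ k : ℤ, n * x = k) :
    ∑ i ∈ Finset.range n, ex (i * x) = 0 := by
  have hx : ex x ≠ 1 := fun h' => h ((ex_eq_one_iff x).1 h')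
  simp only [ex_natCast_mul]
  rw [geom_sum_eq hx, ← ex_natCast_mul, (ex_eq_one_iff _).2 hn, sub_self, zero_div]

/-- The sum is a product of two geometric sums. It can fail to vanish only for `l` in `M` times the
root lattice, whose nonzero elements have some `|l₁|`, `|l₂|` or `|l₁ + l₂|` at least `2M`. This is
where the degree bound `2M - 1` enters. -/
lemma sum_box_expFun {M : ℕ} (hM : 0 < M) {l : ℤ × ℤ} (hl : l ∈ hexagon (2 * M - 1)) :
    ∑ c ∈ box M, expFun l (chart (latticePoint M c.1 c.2)) =
      if l = 0 then 3 * (M : ℂ) ^ 2 else 0 := by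
  have hM' : (M : ℝ) ≠ 0 := by exact_mod_cast hM.ne'
  split_ifs with h
  · subst h
    simp [expFun, ex_zero, box]; ring
  simp only [expFun_chart, latticePoint, box]
  rw [Finset.sum_product]
  simp only [← Finset.mul_sum]
  rw [← Finset.sum_mul]
  have e1 : ∀ i : ℕ, ((l.1 : ℝ) + 2 * l.2) / 3 * (((i : ℤ) : ℝ) / M)
      = i * ((l.1 + 2 * l.2) / (3 * M)) := fun i => by push_cast; field_simp
  have e2 : ∀ i : ℕ, ((l.1 : ℝ) - l.2) / 3 * (((i : ℤ) : ℝ) / M)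
      = i * ((l.1 - l.2) / (3 * M)) := fun i => by push_cast; field_simp
  simp only [e1, e2]
  by_cases hd : ∃ k : ℤ, ((l.1 : ℝ) - l.2) / (3 * M) = k
  · obtain ⟨k, hk⟩ := hd
    have hk' : l.1 - l.2 = 3 * M * k := by
      rw [div_eq_iff (by positivity)] at hk
      have : (l.1 : ℝ) - l.2 = 3 * M * k := by rw [hk]; ring
      exact_mod_cast this
    -- The length-`M` sum closes up only because `l₁ - l₂` is now divisible by `3M`, which makes
    -- `(l₁ + 2 l₂) / 3` an integer.
    rw [sum_ex_eq_zero (n := M), zero_mul]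
    · rintro ⟨i, hi⟩
      have hi' : l.1 + 2 * l.2 = 3 * M * i := by
        rw [div_eq_iff (by positivity)] at hi
        have : (l.1 : ℝ) + 2 * l.2 = 3 * M * i := by rw [hi]; ring
        exact_mod_cast this
      obtain ⟨b1, b2, b3⟩ := hl
      rw [abs_le] at b1 b2 b3
      push_cast [Nat.cast_sub (show 1 ≤ 2 * M by omega)] at b1 b2 b3
      have f2 : l.2 = M * (i - k) := by linarith
      have f1 : l.1 = M * (i + 2 * k) := by linarith
      have f3 : l.1 + l.2 = M * (2 * i + k) := by linarith
      have hMz : (0 : ℤ) < M := by exact_mod_cast hM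
      have g1 : i - k < 2 := by by_contra hc; nlinarith
      have g2 : -2 < i - k := by by_contra hc; nlinarith
      have g3 : i + 2 * k < 2 := by by_contra hc; nlinarith
      have g4 : -2 < i + 2 * k := by by_contra hc; nlinarith
      have g5 : 2 * i + k < 2 := by by_contra hc; nlinarith
      have g6 : -2 < 2 * i + k := by by_contra hc; nlinarith
      obtain rfl : k = 0 := by omega
      obtain rfl : i = 0 := by omega
      exact h (Prod.ext (by simpa using f1) (by simpa using f2))
    · have : l.1 + 2 * l.2 = 3 * (l.2 + M * k) := by linarith
      have h3 : (l.1 : ℝ) + 2 * l.2 = 3 * (l.2 + M * k) := by exact_mod_cast this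
      exact ⟨l.2 + M * k, by push_cast; rw [h3]; field_simp⟩
  · rw [mul_comm, sum_ex_eq_zero hd, zero_mul]
    exact ⟨l.1 - l.2, by push_cast; field_simp⟩

lemma integrableOn_cell {f : ℝ × ℝ → ℂ} (hf : Continuous f) : IntegrableOn f cell := by
  have hK : IsCompact (Set.Icc (0 : ℝ) 1 ×ˢ Set.Icc (0 : ℝ) 3) := isCompact_Icc.prod isCompact_Icc
  exact (hf.continuousOn.integrableOn_compact hK).mono_set
    (Set.prod_mono Set.Ioc_subset_Icc_self Set.Ioc_subset_Icc_self)

/-- By linearity only characters matter. The factor `1/M²` is the area 3 of the cell divided by the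
`3M²` points of the box. -/
lemma integral_cell_eq_sum_box {M : ℕ} (hM : 0 < M) {f : ℝ × ℝ → ℂ}
    (hf : f ∈ trigPoly (2 * M - 1)) :
    ∫ q in cell, f (chart q) =
      (1 / (M : ℂ) ^ 2) * ∑ c ∈ box M, f (chart (latticePoint M c.1 c.2)) := by
  have hM' : (M : ℂ) ≠ 0 := by exact_mod_cast hM.ne'
  induction hf using Submodule.span_induction with
  | mem f hf =>
    obtain ⟨l, hl, rfl⟩ := hf
    rw [integral_expFun_chart, sum_box_expFun hM hl]
    split_ifs
    · field_simp
    · simp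
  | zero => simp
  | add f g hf hg ihf ihg =>
    have cf := integrableOn_cell ((continuous_of_mem_trigPoly hf).comp continuous_chart)
    have cg := integrableOn_cell ((continuous_of_mem_trigPoly hg).comp continuous_chart)
    simp only [Pi.add_apply, Finset.sum_add_distrib, mul_add]
    rw [← ihf, ← ihg]
    exact integral_add cf cg
  | smul c f _ ih =>
    simp only [Pi.smul_apply, smul_eq_mul, ← Finset.mul_sum]
    rw [integral_const_mul, ih]; ring

/-! ### Tiling of the period cell by six triangles, up to null sets. -/

lemma ae_fst_ne (c : ℝ) : ∀ᵐ q : ℝ × ℝ, q.1 ≠ c :=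
  Measure.quasiMeasurePreserving_fst.ae (compl_mem_ae_iff.2 (measure_singleton c))

lemma ae_snd_ne (c : ℝ) : ∀ᵐ q : ℝ × ℝ, q.2 ≠ c :=
  Measure.quasiMeasurePreserving_snd.ae (compl_mem_ae_iff.2 (measure_singleton c))

lemma ae_snd_ne_fst_add (c : ℝ) : ∀ᵐ q : ℝ × ℝ, q.2 ≠ q.1 + c := by
  have hm : MeasurableSet {q : ℝ × ℝ | q.2 = q.1 + c} :=
    measurableSet_eq_fun measurable_snd (measurable_fst.add_const c)
  have : volume {q : ℝ × ℝ | q.2 = q.1 + c} = 0 := by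
    rw [Measure.volume_eq_prod, Measure.measure_prod_null hm]
    refine Filter.Eventually.of_forall fun x => ?_
    have : Prod.mk x ⁻¹' {q : ℝ × ℝ | q.2 = q.1 + c} = {x + c} := by ext; simp
    simp [this]
  exact compl_mem_ae_iff.2 this

/-- The affine map of the plane with the given coefficients. -/
def affineMap (a b c a' b' c' : ℝ) (q : ℝ × ℝ) : ℝ × ℝ :=
  (a * q.1 + b * q.2 + c, a' * q.1 + b' * q.2 + c')

lemma measurePreserving_affineMap {a b c a' b' c' : ℝ} (h : |a * b' - b * a'| = 1) :
    MeasurePreserving (affineMap a b c a' b' c') ∧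
      MeasurableEmbedding (affineMap a b c a' b' c') := by
  set L : (ℝ × ℝ) →ₗ[ℝ] (ℝ × ℝ) :=
    Matrix.toLin (Module.Basis.finTwoProd ℝ) (Module.Basis.finTwoProd ℝ) !![a, b; a', b'] with hL
  have hdet : LinearMap.det L = a * b' - b * a' := by
    rw [hL, LinearMap.det_toLin, Matrix.det_fin_two_of]
  have hdet0 : LinearMap.det L ≠ 0 := by
    intro h0; rw [← hdet, h0] at h; simp at h
  have hLapp : affineMap a b c a' b' c' = (fun q => q + (c, c')) ∘ L := by
    ext1 q
    rw [Function.comp_apply, hL, Matrix.toLin_finTwoProd_apply]; rfl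
  have hLc : Continuous L := L.continuous_of_finiteDimensional
  have hmp : MeasurePreserving L := by
    refine ⟨hLc.measurable, ?_⟩
    rw [Measure.map_linearMap_addHaar_eq_smul_addHaar _ hdet0, hdet, abs_inv, h]
    simp
  have hLi : Function.Injective L := (LinearMap.equivOfDetNeZero L hdet0).injective
  rw [hLapp]
  exact ⟨(measurePreserving_add_right volume (c, c')).comp hmp,
    (measurableEmbedding_addRight (c, c')).comp (hLc.measurableEmbedding hLi)⟩

lemma integral_comp_affineMap {a b c a' b' c' : ℝ} (h : |a * b' - b * a'| = 1)
    (f : ℝ × ℝ → ℂ) : ∫ q, f (affineMap a b c a' b' c' q) = ∫ q, f q :=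
  (measurePreserving_affineMap h).1.integral_comp (measurePreserving_affineMap h).2 f

lemma indicator_cell_ae_eq (h : ℝ × ℝ → ℂ) :
    ∀ᵐ q : ℝ × ℝ, cell.indicator (fun _ => h q) q = T.indicator (fun _ => h q) (q.1, q.2) +
      T.indicator (fun _ => h q) (q.2, q.1) +
      T.indicator (fun _ => h q) (2 - q.2, q.1 - q.2 + 1) +
      T.indicator (fun _ => h q) (1 - q.1, q.2 - q.1 - 1) +
      T.indicator (fun _ => h q) (q.2 - q.1 - 1, 1 - q.1) +
      T.indicator (fun _ => h q) (q.1 - q.2 + 3, 3 - q.2) := by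
  -- Discarded are the inner walls, where closed triangles overlap, and the edges `s = 0` and `u =
  -- 0` missing from the half-open cell.
  filter_upwards [ae_fst_ne 0, ae_snd_ne 0, ae_snd_ne 1, ae_snd_ne 2, ae_snd_ne_fst_add 0,
    ae_snd_ne_fst_add 1, ae_snd_ne_fst_add 2] with q h1 h2 h3 h4 h5 h6 h7
  obtain ⟨s, u⟩ := q
  simp only [Set.indicator_apply, T, cell, Set.mem_ofPred_eq, Set.mem_prod, Set.mem_Ioc] at *
  grind (splits := 25)

lemma isClosed_T : IsClosed T :=
  (isClosed_le continuous_const continuous_snd).inter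
    ((isClosed_le continuous_snd continuous_fst).inter
      (isClosed_le continuous_fst continuous_const))

lemma isCompact_T : IsCompact T := by
  refine (isCompact_Icc.prod isCompact_Icc : IsCompact (Set.Icc (0 : ℝ) 1 ×ˢ Set.Icc (0 : ℝ) 1)
    ).of_isClosed_subset isClosed_T ?_
  rintro q ⟨h0, h1, h2⟩
  exact ⟨⟨h0.trans h1, h2⟩, h0, h1.trans h2⟩

lemma integrable_comp_affineMap {a b c a' b' c' : ℝ} (h : |a * b' - b * a'| = 1)
    {f : ℝ × ℝ → ℂ} (hf : Integrable f) : Integrable fun q => f (affineMap a b c a' b' c' q) :=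
  ((measurePreserving_affineMap h).1.integrable_comp_emb (measurePreserving_affineMap h).2).2 hf

/-! ### Differentiability of `Y` and the folded integral. -/

/-- The derivative of `Y`. -/
noncomputable def fderivY (q : ℝ × ℝ) : ℝ × ℝ →L[ℝ] ℝ × ℝ :=
  let k := 2 * Real.pi / 3
  let A := k * (q.1 + q.2)
  let B := k * (2 * q.1 - q.2)
  let C := k * (2 * q.2 - q.1)
  (Matrix.toLin (Module.Basis.finTwoProd ℝ) (Module.Basis.finTwoProd ℝ)
    !![-k * (Real.sin A + 2 * Real.sin B - Real.sin C),
      -k * (Real.sin A - Real.sin B + 2 * Real.sin C);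
      k * (Real.cos A - 2 * Real.cos B + Real.cos C),
      k * (Real.cos A + Real.cos B - 2 * Real.cos C)]).toContinuousLinearMap

lemma Y_apply (q : ℝ × ℝ) :
    Y q = (Real.cos (2 * Real.pi / 3 * (q.1 + q.2)) + Real.cos (2 * Real.pi / 3 * (2 * q.1 - q.2))
        + Real.cos (2 * Real.pi / 3 * (2 * q.2 - q.1)),
      Real.sin (2 * Real.pi / 3 * (q.1 + q.2)) - Real.sin (2 * Real.pi / 3 * (2 * q.1 - q.2))
        - Real.sin (2 * Real.pi / 3 * (2 * q.2 - q.1))) := by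
  simp only [Y, X, chart]
  ring_nf

lemma hasFDerivAt_Y (q : ℝ × ℝ) : HasFDerivAt Y (fderivY q) q := by
  have hY : Y = fun q => (_, _) := funext Y_apply
  rw [hY, fderivY, Matrix.toLin_finTwoProd_toContinuousLinearMap]
  have hs : HasFDerivAt (fun q : ℝ × ℝ => q.1) (ContinuousLinearMap.fst ℝ ℝ ℝ) q :=
    hasFDerivAt_fst
  have hu : HasFDerivAt (fun q : ℝ × ℝ => q.2) (ContinuousLinearMap.snd ℝ ℝ ℝ) q :=
    hasFDerivAt_snd
  have hA := (hs.add hu).const_mul (2 * Real.pi / 3)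
  have hB := ((hs.const_mul 2).sub hu).const_mul (2 * Real.pi / 3)
  have hC := ((hu.const_mul 2).sub hs).const_mul (2 * Real.pi / 3)
  refine HasFDerivAt.prodMk (((hA.cos.add hB.cos).add hC.cos).congr_fderiv ?_)
    (((hA.sin.sub hB.sin).sub hC.sin).congr_fderiv ?_)
  · ext <;> simp <;> ring
  · ext <;> simp <;> ring

lemma continuous_Y : Continuous Y :=
  continuous_iff_continuousAt.2 fun q => (hasFDerivAt_Y q).continuousAt

/-- The integral over a period cell of a function invariant under the affine Weyl group. -/
lemma integral_cell_eq_six_mul {g : ℝ × ℝ → ℂ} (hg : Continuous g) :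
    ∫ q in cell, g (Y q) = 6 * ∫ q in T, g (Y q) := by
  have hT : MeasurableSet T := isClosed_T.measurableSet
  have hcell : MeasurableSet cell := measurableSet_Ioc.prod measurableSet_Ioc
  set f : ℝ × ℝ → ℂ := T.indicator fun q => g (Y q) with hf
  have hfi : Integrable f :=
    (integrable_indicator_iff hT).2 ((hg.comp continuous_Y).continuousOn.integrableOn_compact isCompact_T)
  have e1 : |(1 : ℝ) * 1 - 0 * 0| = 1 := by norm_num
  have e2 : |(0 : ℝ) * 0 - 1 * 1| = 1 := by norm_num
  have e3 : |(0 : ℝ) * (-1) - (-1) * 1| = 1 := by norm_num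
  have e4 : |(-1 : ℝ) * 1 - 0 * (-1)| = 1 := by norm_num
  have e5 : |(-1 : ℝ) * 0 - 1 * (-1)| = 1 := by norm_num
  have e6 : |(1 : ℝ) * (-1) - (-1) * 0| = 1 := by norm_num
  have hae : cell.indicator (fun q => g (Y q)) =ᵐ[volume]
      (fun q => f (affineMap 1 0 0 0 1 0 q)) + (fun q => f (affineMap 0 1 0 1 0 0 q)) +
      (fun q => f (affineMap 0 (-1) 2 1 (-1) 1 q)) +
      (fun q => f (affineMap (-1) 0 1 (-1) 1 (-1) q)) +
      (fun q => f (affineMap (-1) 1 (-1) (-1) 0 1 q)) +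
      (fun q => f (affineMap 1 (-1) 3 0 (-1) 3 q)) := by
    filter_upwards [indicator_cell_ae_eq fun q => g (Y q)] with q hq
    have i0 : cell.indicator (fun q => g (Y q)) q = cell.indicator (fun _ => g (Y q)) q := rfl
    have key : ∀ q' : ℝ × ℝ, Y q' = Y q → f q' = T.indicator (fun _ => g (Y q)) q' := by
      intro q' h
      by_cases hq' : q' ∈ T <;> simp [hf, hq', h]
    have a1 : affineMap 1 0 0 0 1 0 q = (q.1, q.2) := by ext <;> simp [affineMap]
    have a2 : affineMap 0 1 0 1 0 0 q = (q.2, q.1) := by ext <;> simp [affineMap]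
    have a3 : affineMap 0 (-1) 2 1 (-1) 1 q = (2 - q.2, q.1 - q.2 + 1) := by
      ext <;> simp [affineMap] <;> ring
    have a4 : affineMap (-1) 0 1 (-1) 1 (-1) q = (1 - q.1, q.2 - q.1 - 1) := by
      ext <;> simp [affineMap] <;> ring
    have a5 : affineMap (-1) 1 (-1) (-1) 0 1 q = (q.2 - q.1 - 1, 1 - q.1) := by
      ext <;> simp [affineMap] <;> ring
    have a6 : affineMap 1 (-1) 3 0 (-1) 3 q = (q.1 - q.2 + 3, 3 - q.2) := by
      ext <;> simp [affineMap] <;> ring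
    simp only [Pi.add_apply]
    rw [i0, hq, a1, a2, a3, a4, a5, a6, key _ rfl, key _ (Y_swap _ _), key _ (Y_rot_lower _ _),
      key _ (Y_rot_upper _ _), key _ (Y_rot_upper_swap _ _), key _ (Y_reflect_three _ _)]
  have j1 := integrable_comp_affineMap (c := 0) (c' := 0) e1 hfi
  have j2 := integrable_comp_affineMap (c := 0) (c' := 0) e2 hfi
  have j3 := integrable_comp_affineMap (c := 2) (c' := 1) e3 hfi
  have j4 := integrable_comp_affineMap (c := 1) (c' := -1) e4 hfi
  have j5 := integrable_comp_affineMap (c := -1) (c' := 1) e5 hfi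
  have j6 := integrable_comp_affineMap (c := 3) (c' := 3) e6 hfi
  rw [← integral_indicator hcell, integral_congr_ae hae,
    integral_add' ((((j1.add j2).add j3).add j4).add j5) j6,
    integral_add' (((j1.add j2).add j3).add j4) j5, integral_add' ((j1.add j2).add j3) j4,
    integral_add' (j1.add j2) j3, integral_add' j1 j2,
    integral_comp_affineMap e1, integral_comp_affineMap e2, integral_comp_affineMap e3,
    integral_comp_affineMap e4, integral_comp_affineMap e5, integral_comp_affineMap e6, hf,
    integral_indicator hT]
  ring

/-! ### The Jacobian against the weight. -/

lemma det_fderivY (q : ℝ × ℝ) :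
    (fderivY q).det = -(2 * Real.pi ^ 2 / 3 * sinS (chart q)) := by
  have h1 : 2 * Real.pi * ((chart q).1 + (chart q).2)
      = 2 * Real.pi / 3 * (q.1 + q.2) + 2 * Real.pi / 3 * (2 * q.1 - q.2) := by
    simp only [chart]; ring
  have h2 : 2 * Real.pi * (2 * (chart q).1 - (chart q).2)
      = 2 * Real.pi / 3 * (q.1 + q.2) + 2 * Real.pi / 3 * (2 * q.2 - q.1) := by
    simp only [chart]; ring
  have h3 : 2 * Real.pi * (2 * (chart q).2 - (chart q).1)
      = 2 * Real.pi / 3 * (2 * q.1 - q.2) - 2 * Real.pi / 3 * (2 * q.2 - q.1) := by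
    simp only [chart]; ring
  rw [sinS, h1, h2, h3, Real.sin_add, Real.sin_add, Real.sin_sub]
  simp only [fderivY, LinearMap.det_toContinuousLinearMap, LinearMap.det_toLin,
    Matrix.det_fin_two_of]
  ring

/-- The Weyl denominator formula, with one sine for each positive root; it shows that the Jacobian
vanishes only on the walls. -/
lemma sinS_chart (q : ℝ × ℝ) :
    sinS (chart q) = -8 * (Real.sin (Real.pi * q.2) * Real.sin (Real.pi * (q.1 - q.2)) *
      Real.sin (Real.pi * q.1)) := by
  have h1 : 2 * Real.pi * ((chart q).1 + (chart q).2)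
      = 2 * (Real.pi * q.2 + Real.pi * (q.1 - q.2)) := by
    simp only [chart]; ring
  have h2 : 2 * Real.pi * (2 * (chart q).1 - (chart q).2) = 2 * (Real.pi * q.2) := by
    simp only [chart]; ring
  have h3 : 2 * Real.pi * (2 * (chart q).2 - (chart q).1) = 2 * (Real.pi * (q.1 - q.2)) := by
    simp only [chart]; ring
  have h4 : Real.pi * q.1 = Real.pi * q.2 + Real.pi * (q.1 - q.2) := by ring
  rw [sinS, h1, h2, h3, h4]
  generalize Real.pi * q.2 = x
  generalize Real.pi * (q.1 - q.2) = y
  rw [Real.sin_two_mul, Real.sin_two_mul, Real.sin_two_mul, Real.sin_add, Real.cos_add]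
  have hx := Real.sin_sq_add_cos_sq x
  have hy := Real.sin_sq_add_cos_sq y
  generalize Real.sin x = a at *
  generalize Real.cos x = b at *
  generalize Real.sin y = c at *
  generalize Real.cos y = d at *
  linear_combination (4 * c * d) * hx + (4 * a * b) * hy

lemma sinS_chart_ne_zero {q : ℝ × ℝ} (h0 : 0 < q.2) (h1 : q.2 < q.1) (h2 : q.1 < 1) :
    sinS (chart q) ≠ 0 := by
  have pos : ∀ x : ℝ, 0 < x → x < 1 → Real.sin (Real.pi * x) ≠ 0 := fun x hx hx' =>
    (Real.sin_pos_of_pos_of_lt_pi (by positivity) (by nlinarith [Real.pi_pos])).ne'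
  rw [sinS_chart]
  exact mul_ne_zero (by norm_num) (mul_ne_zero (mul_ne_zero (pos _ h0 (by linarith))
    (pos _ (by linarith) (by linarith))) (pos _ (by linarith) h2))

lemma continuous_value (p : MvPolynomial (Fin 2) ℂ) : Continuous (value p) := by
  unfold value
  refine (MvPolynomial.continuous_eval p).comp (continuous_pi fun i => ?_)
  fin_cases i <;> simp <;> fun_prop

/-- Inside `T` the weight is `1 / |sinS|` and cancels the Jacobian. On the walls the left side is
`0`, so the equality holds only almost everywhere. -/
lemma abs_det_smul_ae_eq (p : MvPolynomial (Fin 2) ℂ) :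
    (fun q => |(fderivY q).det| • (value p (Y q) * ((K (Y q) ^ (-(1 / 2) : ℝ) : ℝ) : ℂ)))
      =ᵐ[volume.restrict T] fun q => ((2 * Real.pi ^ 2 / 3 : ℝ) : ℂ) * value p (Y q) := by
  filter_upwards [ae_restrict_mem isClosed_T.measurableSet, ae_restrict_of_ae (ae_fst_ne 1),
    ae_restrict_of_ae (ae_snd_ne 0), ae_restrict_of_ae (ae_snd_ne_fst_add 0)] with q hq n1 n2 n3
  obtain ⟨h0, h1, h2⟩ := hq
  rw [add_zero] at n3
  have hS := sinS_chart_ne_zero (lt_of_le_of_ne h0 n2.symm) (lt_of_le_of_ne h1 n3)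
    (lt_of_le_of_ne h2 n1)
  have hK : K (Y q) ^ (-(1 / 2) : ℝ) = |sinS (chart q)|⁻¹ := by
    rw [Y, K_X_eq_sinS_sq, Real.rpow_neg (sq_nonneg _), ← Real.sqrt_eq_rpow, Real.sqrt_sq_eq_abs]
  have hd : |(fderivY q).det| = 2 * Real.pi ^ 2 / 3 * |sinS (chart q)| := by
    rw [det_fderivY, abs_neg, abs_mul, abs_of_nonneg (by positivity)]
  rw [hK, hd, Complex.real_smul]
  have hS' : ((|sinS (chart q)| : ℝ) : ℂ) ≠ 0 := by exact_mod_cast abs_ne_zero.2 hS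
  push_cast
  field_simp

end A2

theorem mainTheorem2 (M : ℕ) (hM : 0 < M) :
    A2.Omega = A2.X '' A2.F ∧
    (∀ a : ℝ × ℝ, A2.K (A2.X a) = ‖A2.S (1, 1) a‖ ^ 2) ∧
    (∀ j ∈ A2.I M, A2.orbitSize (A2.gridPoint M j) = A2.eps j) ∧
    ∀ p ∈ A2.Pi (2 * M - 1),
      MeasureTheory.IntegrableOn
        (fun y : ℝ × ℝ => A2.value p y * ((A2.K y ^ (-(1 / 2) : ℝ) : ℝ) : ℂ)) A2.Omega ∧
      ∫ y in A2.Omega, A2.value p y * ((A2.K y ^ (-(1 / 2) : ℝ) : ℝ) : ℂ) =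
        ((Real.pi ^ 2 / (9 * (M : ℝ) ^ 2) : ℝ) : ℂ) *
          ∑ j ∈ A2.I M, (A2.eps j : ℂ) * A2.value p (A2.node M j) := by
  refine ⟨A2.Omega_eq_image, A2.K_X_eq_norm_S_sq, fun j hj => A2.orbitSize_gridPoint hM hj,
    fun p hp => ?_⟩
  have hT : MeasurableSet A2.T := A2.isClosed_T.measurableSet
  have hd : ∀ q ∈ A2.T, HasFDerivWithinAt A2.Y (A2.fderivY q) A2.T q :=
    fun q _ => (A2.hasFDerivAt_Y q).hasFDerivWithinAt
  have hc : Continuous fun q => A2.value p (A2.Y q) :=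
    (A2.continuous_value p).comp A2.continuous_Y
  -- With `Ω` written as an injective image of the compact triangle, integrability and the integral
  -- both follow by change of variables.
  rw [A2.Omega_eq_image, ← A2.Y_image_T]
  constructor
  · rw [integrableOn_image_iff_integrableOn_abs_det_fderiv_smul _ hT hd A2.Y_injOn_T]
    refine Integrable.congr ?_ (A2.abs_det_smul_ae_eq p).symm
    exact (hc.continuousOn.integrableOn_compact A2.isCompact_T).const_mul _
  · rw [integral_image_eq_integral_abs_det_fderiv_smul _ hT hd A2.Y_injOn_T,
      integral_congr_ae (A2.abs_det_smul_ae_eq p), integral_const_mul,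
      ← A2.sum_box_eq_sum_I hM (A2.value p)]
    have h6 := A2.integral_cell_eq_six_mul (A2.continuous_value p)
    have hsum := A2.integral_cell_eq_sum_box hM (A2.value_X_mem hp)
    change ∫ q in A2.cell, A2.value p (A2.Y q) = _ * ∑ c ∈ A2.box M,
      A2.value p (A2.Y (A2.latticePoint M c.1 c.2)) at hsum
    have hI : ∫ q in A2.T, A2.value p (A2.Y q) =
        1 / 6 * ∫ q in A2.cell, A2.value p (A2.Y q) := by rw [h6]; ring
    -- The constant is `(2π²/3) · (1/6) · (1/M²)`: Jacobian, six triangles, lattice average.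
    rw [hI, hsum]
    have hM' : (M : ℂ) ≠ 0 := by exact_mod_cast hM.ne'
    push_cast
    field_simp
    ring
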